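/- Let $d\ge 2$ and let $j:(0,\infty)\to(0,\infty)$ be non-increasing with $\int_{\mathbb R^d}(1\wedge|x|^2)\,j(|x|)\,dx<\infty$; put $k(x,y)=j(|x-y|)$. Let $D\subset\mathbb R^d$ be a non-empty bounded open set whose boundary has Lebesgue measure zero, and write $D^c=\mathbb R^d\setminus D$. For $x\in D^c$ let $\mu(x)=\int_D k(x,y)\,dy\in[0,\infty]$, and let $$m(dx)=\mathbf 1_D(x)\,dx+\mathbf 1_{D^c}(x)\,\mu(x)\,dx ,$$ $$\widehat{\mathcal E}(u,v)=\frac12\iint_{(\mathbb R^d\times\mathbb R^d)\setminus(D^c\times D^c)}(u(x)-u(y))(v(x)-v(y))\,k(x,y)\,dy\,dx ,$$ $$\mathcal F=\{u\in L^2(\mathbb R^d,m):\ \widehat{\mathcal E}(u,u)<\infty\},\qquad \widehat{\mathcal E}_1(u,v)=\widehat{\mathcal E}(u,v)+\langle u,v\rangle_{L^2(\mathbb R^d,m)} .$$ An $\widehat{\mathcal E}$-nest is an increasing sequence $(F_n)$ of closed sets such that $\bigcup_n\{u\in\mathcal F: u=0\ m\text{-a.e. on }\mathbb R^d\setminus F_n\}$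 is $\widehat{\mathcal E}_1$-dense in $\mathcal F$; a set is $\widehat{\mathcal E}$-polar if it is contained in $\bigcap_n(\mathbb R^d\setminus F_n)$ for some $\widehat{\mathcal E}$-nest; a function $f:\mathbb R^d\to\mathbb R$ is $\widehat{\mathcal E}$-quasi-continuous if for some $\widehat{\mathcal E}$-nest $(F_n)$ every restriction $f|_{F_n}$ is continuous. **Theorem.** The form $(\widehat{\mathcal E},\mathcal F)$ is a quasi-regular Dirichlet form on $L^2(\mathbb R^d,m)$. That is, $m$ is $\sigma$-finite with full support; $\widehat{\mathcal E}$ is a nonnegative symmetric bilinear form on $\mathcal F$; $\mathcal F$ is a linear subspace that is dense in $L^2(\mathbb R^d,m)$ and complete for the norm $\widehat{\mathcal E}_1(u,u)^{1/2}$; for every $u\in\mathcal F$ the function $v=(0\vee u)\wedge 1$ lies in $\mathcal F$ and $\widehat{\mathcal E}(v,v)\le\widehat{\mathcal E}(u,u)$; and 1. there is an $\widehat{\mathcal E}$-nest of compact sets; 2. there is an $\widehat{\mathcal E}_1$-dense subset of $\mathcal F$ each of whose elements has an $\widehat{\mathcal E}$-quasi-continuous $m$-version; 3. there are countably many $u_n\in\mathcal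 F$ with $\widehat{\mathcal E}$-quasi-continuous $m$-versions $\tilde u_n$, and an $\widehat{\mathcal E}$-polar set $N$, such that $(\tilde u_n)$ separates the points of $\mathbb R^d\setminus N$. -/

import Mathlib

open MeasureTheory Filter Topology
open scoped ENNReal

noncomputable section

/-! ### Symmetric Dirichlet forms on `L²(X, m)`

A form is given by its domain `dom`, a set of elements of `L²(X, m)`, and a function `E` of two
elements of `L²(X, m)` of which only the values on `dom` matter. -/

namespace DirichletForm

variable {X : Type*} [MeasurableSpace X] {m : Measure X}

/-- `E₁(u, v) = E(u, v) + ⟨u, v⟩_{L²(m)}`. -/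
def formOne (E : Lp ℝ 2 m → Lp ℝ 2 m → ℝ) (u v : Lp ℝ 2 m) : ℝ :=
  E u v + inner ℝ u v

/-- `(E, dom)` is a (symmetric) Dirichlet form on `L²(X, m)`: a densely defined, nonnegative,
symmetric bilinear form that is closed and on which the unit contraction operates. -/
structure IsDirichletForm (dom : Set (Lp ℝ 2 m)) (E : Lp ℝ 2 m → Lp ℝ 2 m → ℝ) : Prop where
  zero_mem : (0 : Lp ℝ 2 m) ∈ dom
  add_mem : ∀ u ∈ dom, ∀ v ∈ dom, u + v ∈ dom
  smul_mem : ∀ (c : ℝ), ∀ u ∈ dom, c • u ∈ dom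
  dense : Dense dom
  symm : ∀ u ∈ dom, ∀ v ∈ dom, E u v = E v u
  add_left : ∀ u ∈ dom, ∀ v ∈ dom, ∀ w ∈ dom, E (u + v) w = E u w + E v w
  smul_left : ∀ (c : ℝ), ∀ u ∈ dom, ∀ v ∈ dom, E (c • u) v = c * E u v
  nonneg : ∀ u ∈ dom, 0 ≤ E u u
  /-- `dom` is complete with respect to the norm `E₁(u, u)^{1/2}`. -/
  closed : ∀ u : ℕ → Lp ℝ 2 m, (∀ n, u n ∈ dom) →
    (∀ ε > 0, ∃ N, ∀ n ≥ N, ∀ l ≥ N, formOne E (u n - u l) (u n - u l) < ε) →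
    ∃ v ∈ dom, Tendsto (fun n => formOne E (u n - v) (u n - v)) atTop (𝓝 0)
  /-- If `u ∈ dom` and `v = (0 ∨ u) ∧ 1`, then `v ∈ dom` and `E(v, v) ≤ E(u, u)`. -/
  markov : ∀ u ∈ dom, ∀ v : Lp ℝ 2 m, (v =ᵐ[m] fun x => min (max (u x) 0) 1) →
    v ∈ dom ∧ E v v ≤ E u u

/-- `S` is an `E₁`-dense subset of the domain. -/
def IsFormDense (dom : Set (Lp ℝ 2 m)) (E : Lp ℝ 2 m → Lp ℝ 2 m → ℝ)
    (S : Set (Lp ℝ 2 m)) : Prop :=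
  S ⊆ dom ∧ ∀ u ∈ dom, ∀ ε > 0, ∃ v ∈ S, formOne E (u - v) (u - v) < ε

/-- The set of `u ∈ dom` with `u = 0` `m`-a.e. on the complement of `A`. -/
def domOn (dom : Set (Lp ℝ 2 m)) (A : Set X) : Set (Lp ℝ 2 m) :=
  {u | u ∈ dom ∧ ∀ᵐ x ∂m, x ∉ A → u x = 0}

variable [TopologicalSpace X]

/-- `(A k)` is an `E`-nest: an increasing sequence of closed sets such that the union of the
spaces `domOn dom (A k)` is `E₁`-dense in `dom`. -/
structure IsNest (dom : Set (Lp ℝ 2 m)) (E : Lp ℝ 2 m → Lp ℝ 2 m → ℝ)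
    (A : ℕ → Set X) : Prop where
  isClosed : ∀ k, IsClosed (A k)
  mono : Monotone A
  dense : IsFormDense dom E (⋃ k, domOn dom (A k))

/-- `N` is `E`-polar: it is contained in the intersection of the complements of the members of
some `E`-nest. -/
def IsPolar (dom : Set (Lp ℝ 2 m)) (E : Lp ℝ 2 m → Lp ℝ 2 m → ℝ) (N : Set X) : Prop :=
  ∃ A : ℕ → Set X, IsNest dom E A ∧ N ⊆ ⋂ k, (A k)ᶜ

/-- `f` is `E`-quasi-continuous: its restriction to each member of some `E`-nest is
continuous. -/
def IsQuasiContinuous (dom : Set (Lp ℝ 2 m)) (E : Lp ℝ 2 m → Lp ℝ 2 m → ℝ)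
    (f : X → ℝ) : Prop :=
  ∃ A : ℕ → Set X, IsNest dom E A ∧ ∀ k, ContinuousOn f (A k)

/-- `f` is an `E`-quasi-continuous `m`-version of `u`. -/
def IsQuasiContinuousVersion (dom : Set (Lp ℝ 2 m)) (E : Lp ℝ 2 m → Lp ℝ 2 m → ℝ)
    (u : Lp ℝ 2 m) (f : X → ℝ) : Prop :=
  u =ᵐ[m] f ∧ IsQuasiContinuous dom E f

/-- `(E, dom)` is a quasi-regular Dirichlet form on `L²(X, m)`. The usual standing assumptions
on `m` (σ-finite with full topological support) are part of the notion. -/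
structure IsQuasiRegularDirichletForm (dom : Set (Lp ℝ 2 m))
    (E : Lp ℝ 2 m → Lp ℝ 2 m → ℝ) : Prop where
  sigmaFinite : SigmaFinite m
  fullSupport : m.IsOpenPosMeasure
  isDirichletForm : IsDirichletForm dom E
  exists_compact_nest : ∃ A : ℕ → Set X, IsNest dom E A ∧ ∀ k, IsCompact (A k)
  exists_dense_quasiContinuous : ∃ S : Set (Lp ℝ 2 m), IsFormDense dom E S ∧
    ∀ u ∈ S, ∃ f : X → ℝ, IsQuasiContinuousVersion dom E u f
  exists_separating : ∃ (u : ℕ → Lp ℝ 2 m) (f : ℕ → X → ℝ) (N : Set X),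
    (∀ n, u n ∈ dom ∧ IsQuasiContinuousVersion dom E (u n) (f n)) ∧ IsPolar dom E N ∧
    ∀ x ∉ N, ∀ y ∉ N, x ≠ y → ∃ n, f n x ≠ f n y

end DirichletForm

/-! ### The non-local form -/

namespace NonlocalForm

variable {d : ℕ}

/-- The kernel `k(x, y) = j(|x - y|)`. -/
def kernel (j : ℝ → ℝ) (x y : EuclideanSpace ℝ (Fin d)) : ℝ := j ‖x - y‖

/-- `μ(x) = ∫_D k(x, y) dy`, as an element of `[0, ∞]` (the value may be `∞` on `∂D`). -/
def mu (j : ℝ → ℝ) (D : Set (EuclideanSpace ℝ (Fin d))) (x : EuclideanSpace ℝ (Fin d)) : ℝ≥0∞ :=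
  ∫⁻ y in D, ENNReal.ofReal (kernel j x y)

/-- The measure `m(dx) = 1_D(x) dx + 1_{Dᶜ}(x) μ(x) dx`. -/
def refMeasure (j : ℝ → ℝ) (D : Set (EuclideanSpace ℝ (Fin d))) :
    Measure (EuclideanSpace ℝ (Fin d)) :=
  volume.restrict D + (volume.restrict Dᶜ).withDensity (mu j D)

/-- `Ê(u, u)` as an element of `[0, ∞]`. -/
def energy (j : ℝ → ℝ) (D : Set (EuclideanSpace ℝ (Fin d)))
    (u : EuclideanSpace ℝ (Fin d) → ℝ) : ℝ≥0∞ :=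
  2⁻¹ * ∫⁻ p in (Dᶜ ×ˢ Dᶜ)ᶜ, ENNReal.ofReal ((u p.1 - u p.2) ^ 2 * kernel j p.1 p.2)
    ∂((volume : Measure (EuclideanSpace ℝ (Fin d))).prod volume)

/-- `Ê(u, v)`, the integral being taken over `(ℝᵈ × ℝᵈ) \ (Dᶜ × Dᶜ)`. -/
def form (j : ℝ → ℝ) (D : Set (EuclideanSpace ℝ (Fin d)))
    (u v : EuclideanSpace ℝ (Fin d) → ℝ) : ℝ :=
  2⁻¹ * ∫ p in (Dᶜ ×ˢ Dᶜ)ᶜ, (u p.1 - u p.2) * (v p.1 - v p.2) * kernel j p.1 p.2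
    ∂((volume : Measure (EuclideanSpace ℝ (Fin d))).prod volume)

/-- `F = {u ∈ L²(ℝᵈ, m) : Ê(u, u) < ∞}`. -/
def formDomain (j : ℝ → ℝ) (D : Set (EuclideanSpace ℝ (Fin d))) :
    Set (Lp ℝ 2 (refMeasure j D)) :=
  {u | energy j D u < ∞}

/-- `Ê` as a function of two elements of `L²(ℝᵈ, m)`. -/
def formLp (j : ℝ → ℝ) (D : Set (EuclideanSpace ℝ (Fin d)))
    (u v : Lp ℝ 2 (refMeasure j D)) : ℝ :=
  form j D u v

end NonlocalForm

end

/-!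
A function in the domain splits as `u = 1_D u + 1_{Dᶜ} u`, and the two parts behave differently.

On functions that vanish on `D` the `E₁`-norm is equivalent to the `L²(m)`-norm, because a relevant
jump out of `Dᶜ` lands in `D` and `μ` is the rate of such jumps. The exterior part of the domain is
therefore a plain weighted `L²`-space, in which continuous functions supported by the compact sets
`{x : dist(x, D) ≥ 1 / (k + 1), |x| ≤ k}` are dense.

On functions that vanish off `D` the form is that of a translation invariant form on `ℝᵈ`, where
mollification gives continuous approximations. Passing to a rapidly converging subsequence and
taking suprema of capped increments produces versions that are continuous on closed sets `B k`,
together with cutoff functions of vanishing energy that equal `1` off `B k`.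

The nest is made of the sets `B k ∩ closure D`, joined with the exterior compact sets. The points
of `frontier D` are the delicate ones: shrinking `B k` to the set where one of the first functions
of a countable dense family of functions vanishing off `D` is at least `1 / (k + 1)` in absolute
value makes the points where the whole family vanishes polar. The family, multiplied by truncated
coordinates, then separates the remaining points.
-/

noncomputable section

namespace JumpForm

open DirichletForm

section LintegralSq

variable {Y : Type*} [MeasurableSpace Y] {μ : Measure Y}

/-- `∫ f² dμ` as an element of `[0, ∞]`. -/
def lintegralSq (μ : Measure Y) (f : Y → ℝ) : ℝ≥0∞ := ∫⁻ x, ENNReal.ofReal (f x ^ 2) ∂μ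

theorem lintegralSq_eq_eLpNorm_sq (f : Y → ℝ) : lintegralSq μ f = eLpNorm f 2 μ ^ 2 := by
  have h := eLpNorm_nnreal_pow_eq_lintegral (f := f) (μ := μ) (p := 2) two_ne_zero
  simp only [NNReal.coe_ofNat, ENNReal.rpow_ofNat, ENNReal.coe_ofNat] at h
  rw [h, lintegralSq]
  refine lintegral_congr fun x => ?_
  rw [← sq_abs, ENNReal.ofReal_pow (abs_nonneg _), ← Real.enorm_eq_ofReal_abs]

theorem memLp_two_iff_lintegralSq_lt_top {f : Y → ℝ} (hf : AEStronglyMeasurable f μ) :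
    MemLp f 2 μ ↔ lintegralSq μ f < ∞ := by
  rw [lintegralSq_eq_eLpNorm_sq, MemLp, ENNReal.pow_lt_top_iff]
  simp [hf]

theorem lintegralSq_coe (u : Lp ℝ 2 μ) : lintegralSq μ u = ENNReal.ofReal (‖u‖ ^ 2) := by
  rw [lintegralSq_eq_eLpNorm_sq, ENNReal.ofReal_pow (norm_nonneg _), ofReal_norm, Lp.enorm_def]

theorem lintegralSq_coe_lt_top (u : Lp ℝ 2 μ) : lintegralSq μ u < ∞ :=
  lintegralSq_coe u ▸ ENNReal.ofReal_lt_top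

theorem lintegralSq_congr_ae {f g : Y → ℝ} (h : f =ᵐ[μ] g) :
    lintegralSq μ f = lintegralSq μ g :=
  lintegral_congr_ae (h.mono fun x hx => by simp only [hx])

theorem lintegralSq_mono_abs {f g : Y → ℝ} (h : ∀ᵐ x ∂μ, |f x| ≤ |g x|) :
    lintegralSq μ f ≤ lintegralSq μ g :=
  lintegral_mono_ae (h.mono fun _ hx => ENNReal.ofReal_le_ofReal (sq_le_sq.2 hx))

theorem lintegralSq_add_le {f g : Y → ℝ} (hf : AEStronglyMeasurable f μ) :
    lintegralSq μ (f + g) ≤ 2 * (lintegralSq μ f + lintegralSq μ g) := by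
  unfold lintegralSq
  rw [← lintegral_add_left' (by fun_prop), ← lintegral_const_mul' _ _ (by simp)]
  refine lintegral_mono fun x => ?_
  rw [← ENNReal.ofReal_add (sq_nonneg _) (sq_nonneg _), ← ENNReal.ofReal_ofNat 2,
    ← ENNReal.ofReal_mul zero_le_two]
  exact ENNReal.ofReal_le_ofReal add_sq_le

theorem lintegralSq_const_mul (c : ℝ) (f : Y → ℝ) :
    lintegralSq μ (fun x => c * f x) = ENNReal.ofReal (c ^ 2) * lintegralSq μ f := by
  simp only [lintegralSq, mul_pow, ENNReal.ofReal_mul (sq_nonneg c)]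
  exact lintegral_const_mul' _ _ ENNReal.ofReal_ne_top

theorem lintegralSq_mul_le_of_abs_le {f g : Y → ℝ} {c : ℝ} (hf : ∀ x, |f x| ≤ c) :
    lintegralSq μ (f * g) ≤ ENNReal.ofReal (c ^ 2) * lintegralSq μ g := by
  rw [← lintegralSq_const_mul]
  refine lintegralSq_mono_abs (ae_of_all _ fun x => ?_)
  rw [Pi.mul_apply, abs_mul, abs_mul]
  exact mul_le_mul_of_nonneg_right ((hf x).trans (le_abs_self c)) (abs_nonneg _)

theorem tendsto_lintegralSq_zero_of_dominated {f : ℕ → Y → ℝ} {g : Y → ℝ}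
    (hf : ∀ n, AEStronglyMeasurable (f n) μ) (hg : lintegralSq μ g < ∞)
    (hfg : ∀ n, ∀ᵐ x ∂μ, |f n x| ≤ |g x|)
    (h : ∀ᵐ x ∂μ, Tendsto (fun n => f n x) atTop (𝓝 0)) :
    Tendsto (fun n => lintegralSq μ (f n)) atTop (𝓝 0) := by
  rw [← lintegral_zero (μ := μ)]
  refine tendsto_lintegral_of_dominated_convergence' (fun x => ENNReal.ofReal (g x ^ 2))
    (fun n => by have := hf n; fun_prop)
    (fun n => (hfg n).mono fun _ hx => ENNReal.ofReal_le_ofReal (sq_le_sq.2 hx)) hg.ne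
    (h.mono fun x hx => ?_)
  simpa using ENNReal.tendsto_ofReal (hx.pow 2)

end LintegralSq

section JumpMeasure

variable {X : Type*}

/-- The increments `(x, y) ↦ u x - u y` of a function `u`. -/
def increment : (X → ℝ) →ₗ[ℝ] X × X → ℝ :=
  LinearMap.funLeft ℝ ℝ Prod.fst - LinearMap.funLeft ℝ ℝ Prod.snd

theorem increment_apply (u : X → ℝ) (p : X × X) : increment u p = u p.1 - u p.2 := rfl

theorem abs_increment_comp_le {φ : ℝ → ℝ} (hφ : LipschitzWith 1 φ) (u : X → ℝ) (p : X × X) :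
    |increment (φ ∘ u) p| ≤ |increment u p| := by
  simpa [Real.dist_eq, increment_apply] using hφ.dist_le_mul (u p.1) (u p.2)

variable [MeasurableSpace X] {m : Measure X} {ν : Measure (X × X)}

section EnergyOne

/-- `∬ (u x - u y)² dν + ∫ u² dm` as an element of `[0, ∞]`, where `ν` is the jump measure of a
form on `L²(m)`; it is comparable with the square of the `E₁`-norm of `u`. -/
def energyOne (m : Measure X) (ν : Measure (X × X)) (u : X → ℝ) : ℝ≥0∞ :=
  lintegralSq ν (increment u) + lintegralSq m u

/-- A Borel function that represents an element of the domain of the form with jump measure `ν`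
on `L²(m)`. -/
structure HasFiniteEnergy (m : Measure X) (ν : Measure (X × X)) (u : X → ℝ) : Prop where
  measurable : Measurable u
  lt_top : energyOne m ν u < ∞

/-- Both coordinate projections pull back `m`-null sets to `ν`-null sets, so that the increments
of an `m`-class of functions are defined `ν`-a.e. -/
structure HasACMarginals (m : Measure X) (ν : Measure (X × X)) : Prop where
  fst : Measure.QuasiMeasurePreserving Prod.fst ν m
  snd : Measure.QuasiMeasurePreserving Prod.snd ν m

theorem energyOne_neg (u : X → ℝ) : energyOne m ν (-u) = energyOne m ν u := by
  simp only [energyOne, lintegralSq, map_neg, Pi.neg_apply, neg_sq]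

theorem energyOne_sub_comm (u v : X → ℝ) : energyOne m ν (u - v) = energyOne m ν (v - u) := by
  rw [← energyOne_neg, neg_sub]

theorem energyOne_comp_le {φ : ℝ → ℝ} (hφ : LipschitzWith 1 φ) (h0 : φ 0 = 0) (u : X → ℝ) :
    energyOne m ν (φ ∘ u) ≤ energyOne m ν u := by
  refine add_le_add (lintegralSq_mono_abs (ae_of_all _ (abs_increment_comp_le hφ u)))
    (lintegralSq_mono_abs (ae_of_all _ fun x => ?_))
  simpa [h0, Real.dist_eq] using hφ.dist_le_mul (u x) 0

theorem lintegralSq_increment_mul_le {χ u : X → ℝ} (hχ : Measurable χ) (hu : Measurable u) :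
    lintegralSq ν (increment (χ * u)) ≤
      2 * (lintegralSq ν (fun p => χ p.1 * increment u p) +
        lintegralSq ν fun p => u p.2 * increment χ p) := by
  have hsplit : increment (χ * u) =
      (fun p => χ p.1 * increment u p) + fun p => u p.2 * increment χ p := by
    funext p
    simp only [increment_apply, Pi.mul_apply, Pi.add_apply]
    ring
  have hm : Measurable fun p => χ p.1 * increment u p := by
    simp only [increment_apply]
    fun_prop
  rw [hsplit]
  exact lintegralSq_add_le hm.aestronglyMeasurable

theorem memLp_of_energyOne_lt_top {f : X → ℝ} (hf : AEStronglyMeasurable f m)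
    (hf' : energyOne m ν f < ∞) : MemLp f 2 m :=
  (memLp_two_iff_lintegralSq_lt_top hf).2 (lt_of_le_of_lt le_add_self hf')

theorem HasFiniteEnergy.memLp {u : X → ℝ} (hu : HasFiniteEnergy m ν u) : MemLp u 2 m :=
  memLp_of_energyOne_lt_top hu.measurable.aestronglyMeasurable hu.lt_top

theorem HasFiniteEnergy.comp_lipschitz {u : X → ℝ} (hu : HasFiniteEnergy m ν u) {φ : ℝ → ℝ}
    (hφ : LipschitzWith 1 φ) (h0 : φ 0 = 0) : HasFiniteEnergy m ν (φ ∘ u) :=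
  ⟨hφ.continuous.measurable.comp hu.measurable,
    (energyOne_comp_le hφ h0 u).trans_lt hu.lt_top⟩

namespace HasACMarginals

theorem increment_congr (h : HasACMarginals m ν) {u v : X → ℝ} (huv : u =ᵐ[m] v) :
    increment u =ᵐ[ν] increment v := by
  filter_upwards [h.fst.ae huv, h.snd.ae huv] with p h1 h2
  rw [increment_apply, increment_apply, h1, h2]

theorem aestronglyMeasurable_increment (h : HasACMarginals m ν) {u : X → ℝ}
    (hu : AEStronglyMeasurable u m) : AEStronglyMeasurable (increment u) ν :=
  (hu.comp_quasiMeasurePreserving h.fst).sub (hu.comp_quasiMeasurePreserving h.snd)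

theorem energyOne_congr (h : HasACMarginals m ν) {u v : X → ℝ} (huv : u =ᵐ[m] v) :
    energyOne m ν u = energyOne m ν v := by
  rw [energyOne, energyOne, lintegralSq_congr_ae (h.increment_congr huv),
    lintegralSq_congr_ae huv]

theorem energyOne_add_le (h : HasACMarginals m ν) {u v : X → ℝ}
    (hu : AEStronglyMeasurable u m) :
    energyOne m ν (u + v) ≤ 2 * (energyOne m ν u + energyOne m ν v) := by
  have hν := lintegralSq_add_le (g := increment v) (h.aestronglyMeasurable_increment hu)
  rw [← map_add] at hν
  refine (add_le_add hν (lintegralSq_add_le (g := v) hu)).trans_eq ?_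
  simp only [energyOne]
  ring

theorem energyOne_sub_le (h : HasACMarginals m ν) {u v : X → ℝ} (w : X → ℝ)
    (hu : AEStronglyMeasurable u m) (hw : AEStronglyMeasurable w m) :
    energyOne m ν (u - v) ≤ 2 * (energyOne m ν (u - w) + energyOne m ν (w - v)) := by
  rw [← sub_add_sub_cancel u w v]
  exact h.energyOne_add_le (hu.sub hw)

theorem hasFiniteEnergy_add (h : HasACMarginals m ν) {u v : X → ℝ} (hu : HasFiniteEnergy m ν u)
    (hv : HasFiniteEnergy m ν v) : HasFiniteEnergy m ν (u + v) :=
  ⟨hu.measurable.add hv.measurable,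
    (h.energyOne_add_le hu.measurable.aestronglyMeasurable).trans_lt
      (ENNReal.mul_lt_top (by simp) (ENNReal.add_lt_top.2 ⟨hu.lt_top, hv.lt_top⟩))⟩

theorem hasFiniteEnergy_sub (h : HasACMarginals m ν) {u v : X → ℝ} (hu : HasFiniteEnergy m ν u)
    (hv : HasFiniteEnergy m ν v) : HasFiniteEnergy m ν (u - v) := by
  rw [sub_eq_add_neg]
  exact h.hasFiniteEnergy_add hu ⟨hv.measurable.neg, by rw [energyOne_neg]; exact hv.lt_top⟩

theorem hasFiniteEnergy_of_sub_lt_top (h : HasACMarginals m ν) {u v : X → ℝ}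
    (hu : HasFiniteEnergy m ν u) (hv : Measurable v) (huv : energyOne m ν (u - v) < ∞) :
    HasFiniteEnergy m ν v := by
  rw [← sub_sub_cancel u v]
  exact h.hasFiniteEnergy_sub hu ⟨hu.measurable.sub hv, huv⟩

end HasACMarginals

end EnergyOne

section DirichletForm

/-- The elements of `L²(m)` with `∬ (u x - u y)² dν < ∞`. -/
def jumpDomain (m : Measure X) (ν : Measure (X × X)) : Set (Lp ℝ 2 m) :=
  {u | lintegralSq ν (increment u) < ∞}

/-- The form `½ ∬ (u x - u y) (v x - v y) dν` on `L²(m)`. -/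
def jumpForm (m : Measure X) (ν : Measure (X × X)) (u v : Lp ℝ 2 m) : ℝ :=
  2⁻¹ * ∫ p, increment u p * increment v p ∂ν

theorem mem_jumpDomain_iff {u : Lp ℝ 2 m} : u ∈ jumpDomain m ν ↔ energyOne m ν u < ∞ := by
  simp [jumpDomain, energyOne, lintegralSq_coe_lt_top]

theorem mem_jumpDomain_of_memLp {u : Lp ℝ 2 m} (hu : MemLp (increment u) 2 ν) :
    u ∈ jumpDomain m ν :=
  (memLp_two_iff_lintegralSq_lt_top hu.1).1 hu

theorem hasFiniteEnergy_coe {u : Lp ℝ 2 m} (hu : u ∈ jumpDomain m ν) : HasFiniteEnergy m ν u :=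
  ⟨(Lp.stronglyMeasurable u).measurable, mem_jumpDomain_iff.1 hu⟩

namespace HasACMarginals

theorem toLp_mem_jumpDomain (h : HasACMarginals m ν) {f : X → ℝ} (hf : MemLp f 2 m)
    (hf' : energyOne m ν f < ∞) : hf.toLp f ∈ jumpDomain m ν := by
  rwa [mem_jumpDomain_iff, h.energyOne_congr hf.coeFn_toLp]

theorem memLp_increment (h : HasACMarginals m ν) {u : Lp ℝ 2 m} (hu : u ∈ jumpDomain m ν) :
    MemLp (increment u) 2 ν :=
  (memLp_two_iff_lintegralSq_lt_top
    (h.aestronglyMeasurable_increment (Lp.aestronglyMeasurable u))).2 hu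

theorem increment_coe_add (h : HasACMarginals m ν) (u v : Lp ℝ 2 m) :
    increment (u + v : Lp ℝ 2 m) =ᵐ[ν] increment u + increment v := by
  rw [← map_add]
  exact h.increment_congr (Lp.coeFn_add u v)

theorem increment_coe_sub (h : HasACMarginals m ν) (u v : Lp ℝ 2 m) :
    increment (u - v : Lp ℝ 2 m) =ᵐ[ν] increment u - increment v := by
  rw [← map_sub]
  exact h.increment_congr (Lp.coeFn_sub u v)

theorem increment_coe_smul (h : HasACMarginals m ν) (c : ℝ) (u : Lp ℝ 2 m) :
    increment (c • u : Lp ℝ 2 m) =ᵐ[ν] c • increment u := by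
  rw [← map_smul]
  exact h.increment_congr (Lp.coeFn_smul c u)

/-- The domain as a submodule of `L²(m)`. -/
def domainSubmodule (h : HasACMarginals m ν) : Submodule ℝ (Lp ℝ 2 m) where
  carrier := jumpDomain m ν
  add_mem' {u v} hu hv := mem_jumpDomain_of_memLp
    (((h.memLp_increment hu).add (h.memLp_increment hv)).ae_eq (h.increment_coe_add u v).symm)
  zero_mem' := by
    rw [mem_jumpDomain_iff, h.energyOne_congr (Lp.coeFn_zero ℝ 2 m)]
    simp [energyOne, lintegralSq]
  smul_mem' c u hu := mem_jumpDomain_of_memLp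
    (((h.memLp_increment hu).const_smul c).ae_eq (h.increment_coe_smul c u).symm)

theorem sub_mem_jumpDomain (h : HasACMarginals m ν) {u v : Lp ℝ 2 m} (hu : u ∈ jumpDomain m ν)
    (hv : v ∈ jumpDomain m ν) : u - v ∈ jumpDomain m ν :=
  h.domainSubmodule.sub_mem hu hv

theorem jumpForm_self (h : HasACMarginals m ν) (u : Lp ℝ 2 m) :
    jumpForm m ν u u = 2⁻¹ * (lintegralSq ν (increment u)).toReal := by
  have hu := h.aestronglyMeasurable_increment (Lp.aestronglyMeasurable u)
  rw [jumpForm, integral_eq_lintegral_of_nonneg_ae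
    (ae_of_all _ fun p => mul_self_nonneg _) (hu.mul hu), lintegralSq]
  simp only [sq]

theorem formOne_jumpForm_self_le (h : HasACMarginals m ν) {u : Lp ℝ 2 m}
    (hu : u ∈ jumpDomain m ν) :
    formOne (jumpForm m ν) u u ≤ (energyOne m ν u).toReal := by
  rw [formOne, h.jumpForm_self, real_inner_self_eq_norm_sq, energyOne,
    ENNReal.toReal_add (lt_top_iff_ne_top.1 hu) (lintegralSq_coe_lt_top u).ne, lintegralSq_coe u,
    ENNReal.toReal_ofReal (sq_nonneg _)]
  linarith [ENNReal.toReal_nonneg (a := lintegralSq ν (increment u))]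

/-- The increments of an element of the domain as an element of `L²(ν)`. -/
def incrementLp (h : HasACMarginals m ν) {u : Lp ℝ 2 m} (hu : u ∈ jumpDomain m ν) : Lp ℝ 2 ν :=
  (h.memLp_increment hu).toLp _

theorem incrementLp_sub (h : HasACMarginals m ν) {u v : Lp ℝ 2 m} (hu : u ∈ jumpDomain m ν)
    (hv : v ∈ jumpDomain m ν) :
    h.incrementLp (h.sub_mem_jumpDomain hu hv) = h.incrementLp hu - h.incrementLp hv := by
  rw [incrementLp, incrementLp, incrementLp, ← MemLp.toLp_sub]
  exact MemLp.toLp_congr _ _ (h.increment_coe_sub u v)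

theorem lintegralSq_increment_sub (h : HasACMarginals m ν) {u v : Lp ℝ 2 m}
    (hu : u ∈ jumpDomain m ν) (hv : v ∈ jumpDomain m ν) :
    lintegralSq ν (increment (u - v : Lp ℝ 2 m)) =
      ENNReal.ofReal (‖h.incrementLp hu - h.incrementLp hv‖ ^ 2) := by
  rw [← h.incrementLp_sub, ← lintegralSq_coe, incrementLp,
    lintegralSq_congr_ae (MemLp.coeFn_toLp _)]

theorem formOne_jumpForm_sub_self (h : HasACMarginals m ν) {u v : Lp ℝ 2 m}
    (hu : u ∈ jumpDomain m ν) (hv : v ∈ jumpDomain m ν) :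
    formOne (jumpForm m ν) (u - v) (u - v) =
      2⁻¹ * ‖h.incrementLp hu - h.incrementLp hv‖ ^ 2 + ‖u - v‖ ^ 2 := by
  rw [formOne, h.jumpForm_self, real_inner_self_eq_norm_sq, h.lintegralSq_increment_sub hu hv,
    ENNReal.toReal_ofReal (sq_nonneg _)]

theorem incrementLp_closed (h : HasACMarginals m ν) {u : ℕ → Lp ℝ 2 m}
    (hu : ∀ n, u n ∈ jumpDomain m ν) {v : Lp ℝ 2 m} {w : Lp ℝ 2 ν}
    (hv : Tendsto u atTop (𝓝 v)) (hw : Tendsto (fun n => h.incrementLp (hu n)) atTop (𝓝 w)) :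
    ∃ hv : v ∈ jumpDomain m ν, h.incrementLp hv = w := by
  obtain ⟨s, hs, hsv⟩ := (tendstoInMeasure_of_tendsto_Lp hv).exists_seq_tendsto_ae
  obtain ⟨t, ht, htw⟩ := (tendstoInMeasure_of_tendsto_Lp
    (hw.comp hs.tendsto_atTop)).exists_seq_tendsto_ae
  have hincr : ∀ᵐ p ∂ν, ∀ n, h.incrementLp (hu n) p = increment (u n) p :=
    ae_all_iff.2 fun n => (h.memLp_increment (hu n)).coeFn_toLp
  have hvw : w =ᵐ[ν] increment v := by
    filter_upwards [htw, h.fst.ae hsv, h.snd.ae hsv, hincr] with p hp h1 h2 h3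
    refine tendsto_nhds_unique hp ?_
    simp only [Function.comp_apply, h3]
    exact (h1.sub h2).comp ht.tendsto_atTop
  have hvm := mem_jumpDomain_of_memLp ((Lp.memLp w).ae_eq hvw)
  exact ⟨hvm, Lp.ext ((h.memLp_increment hvm).coeFn_toLp.trans hvw.symm)⟩

end HasACMarginals

theorem cauchySeq_of_forall_norm_sq_sub_lt {V : Type*} [SeminormedAddCommGroup V] {u : ℕ → V}
    (hu : ∀ ε > 0, ∃ N, ∀ n ≥ N, ∀ l ≥ N, ‖u n - u l‖ ^ 2 < ε) : CauchySeq u := by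
  refine Metric.cauchySeq_iff.2 fun ε hε => ?_
  obtain ⟨N, hN⟩ := hu (ε ^ 2) (by positivity)
  refine ⟨N, fun n hn l hl => ?_⟩
  rw [dist_eq_norm]
  exact lt_of_pow_lt_pow_left₀ 2 hε.le (hN n hn l hl)

namespace HasACMarginals

theorem exists_tendsto_formOne_sub (h : HasACMarginals m ν) (u : ℕ → Lp ℝ 2 m)
    (hu : ∀ n, u n ∈ jumpDomain m ν)
    (hc : ∀ ε > 0, ∃ N, ∀ n ≥ N, ∀ l ≥ N,
      formOne (jumpForm m ν) (u n - u l) (u n - u l) < ε) :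
    ∃ v ∈ jumpDomain m ν,
      Tendsto (fun n => formOne (jumpForm m ν) (u n - v) (u n - v)) atTop (𝓝 0) := by
  simp only [h.formOne_jumpForm_sub_self (hu _) (hu _)] at hc
  have hcu : CauchySeq u := cauchySeq_of_forall_norm_sq_sub_lt fun ε hε => by
    obtain ⟨N, hN⟩ := hc ε hε
    refine ⟨N, fun n hn l hl => (le_add_of_nonneg_left ?_).trans_lt (hN n hn l hl)⟩
    positivity
  have hci : CauchySeq fun n => h.incrementLp (hu n) :=
    cauchySeq_of_forall_norm_sq_sub_lt fun ε hε => by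
      obtain ⟨N, hN⟩ := hc (2⁻¹ * ε) (by positivity)
      exact ⟨N, fun n hn l hl => by linarith [hN n hn l hl, sq_nonneg ‖u n - u l‖]⟩
  obtain ⟨v, hv⟩ := cauchySeq_tendsto_of_complete hcu
  obtain ⟨w, hw⟩ := cauchySeq_tendsto_of_complete hci
  obtain ⟨hvm, rfl⟩ := h.incrementLp_closed hu hv hw
  refine ⟨v, hvm, ?_⟩
  simp only [fun n => h.formOne_jumpForm_sub_self (hu n) hvm]
  have hw' := (tendsto_iff_norm_sub_tendsto_zero.1 hw).pow 2
  have hv' := (tendsto_iff_norm_sub_tendsto_zero.1 hv).pow 2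
  simpa using (hw'.const_mul 2⁻¹).add hv'

theorem jumpForm_add_left (h : HasACMarginals m ν) {u v w : Lp ℝ 2 m}
    (hu : u ∈ jumpDomain m ν) (hv : v ∈ jumpDomain m ν) (hw : w ∈ jumpDomain m ν) :
    jumpForm m ν (u + v) w = jumpForm m ν u w + jumpForm m ν v w := by
  have huw := (h.memLp_increment hu).integrable_mul (h.memLp_increment hw)
  have hvw := (h.memLp_increment hv).integrable_mul (h.memLp_increment hw)
  simp only [jumpForm, Pi.mul_def] at huw hvw ⊢
  rw [← mul_add, ← integral_add huw hvw]
  congr 1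
  refine integral_congr_ae ((h.increment_coe_add u v).mono fun p hp => ?_)
  simp only [hp, Pi.add_apply, add_mul]

theorem jumpForm_smul_left (h : HasACMarginals m ν) (c : ℝ) (u v : Lp ℝ 2 m) :
    jumpForm m ν (c • u) v = c * jumpForm m ν u v := by
  simp only [jumpForm]
  rw [mul_left_comm c, ← integral_const_mul c]
  congr 1
  refine integral_congr_ae ((h.increment_coe_smul c u).mono fun p hp => ?_)
  simp only [hp, Pi.smul_apply, smul_eq_mul, mul_assoc]

theorem jumpForm_unitContraction (h : HasACMarginals m ν) {u v : Lp ℝ 2 m}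
    (hu : u ∈ jumpDomain m ν) (hv : v =ᵐ[m] fun x => min (max (u x) 0) 1) :
    v ∈ jumpDomain m ν ∧ jumpForm m ν v v ≤ jumpForm m ν u u := by
  have hφ : LipschitzWith 1 fun t : ℝ => min (max t 0) 1 :=
    (LipschitzWith.id.max_const 0).min_const 1
  have hle : lintegralSq ν (increment v) ≤ lintegralSq ν (increment u) := by
    rw [lintegralSq_congr_ae (h.increment_congr hv)]
    exact lintegralSq_mono_abs (ae_of_all _ (abs_increment_comp_le hφ u))
  refine ⟨hle.trans_lt hu, ?_⟩
  rw [h.jumpForm_self, h.jumpForm_self]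
  gcongr
  exact lt_top_iff_ne_top.1 hu

theorem isDirichletForm (h : HasACMarginals m ν) (hd : Dense (jumpDomain m ν)) :
    IsDirichletForm (jumpDomain m ν) (jumpForm m ν) where
  zero_mem := h.domainSubmodule.zero_mem
  add_mem _ hu _ hv := h.domainSubmodule.add_mem hu hv
  smul_mem c _ hu := h.domainSubmodule.smul_mem c hu
  dense := hd
  symm u _ v _ := by simp only [jumpForm, mul_comm]
  add_left _ hu _ hv _ hw := h.jumpForm_add_left hu hv hw
  smul_left c u _ v _ := h.jumpForm_smul_left c u v
  nonneg u _ := by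
    rw [h.jumpForm_self]
    positivity
  closed := h.exists_tendsto_formOne_sub
  markov _ hu _ hv := h.jumpForm_unitContraction hu hv

end HasACMarginals

end DirichletForm

section Density

namespace HasACMarginals

theorem isFormDense (h : HasACMarginals m ν) {S : Set (Lp ℝ 2 m)} (hS : S ⊆ jumpDomain m ν)
    (hd : ∀ u, HasFiniteEnergy m ν u → ∀ ε > 0, ∃ v ∈ S, energyOne m ν (u - v) < ε) :
    IsFormDense (jumpDomain m ν) (jumpForm m ν) S := by
  refine ⟨hS, fun u hu ε hε => ?_⟩
  obtain ⟨v, hv, huv⟩ := hd u (hasFiniteEnergy_coe hu) (ENNReal.ofReal ε)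
    (ENNReal.ofReal_pos.2 hε)
  refine ⟨v, hv, (h.formOne_jumpForm_self_le (h.sub_mem_jumpDomain hu (hS hv))).trans_lt ?_⟩
  rw [h.energyOne_congr (Lp.coeFn_sub u v)]
  exact (ENNReal.lt_ofReal_iff_toReal_lt (huv.trans ENNReal.ofReal_lt_top).ne).1 huv

theorem isNest [TopologicalSpace X] (h : HasACMarginals m ν) {A : ℕ → Set X}
    (hA : ∀ k, IsClosed (A k)) (hmono : Monotone A)
    (hd : ∀ u, HasFiniteEnergy m ν u → ∀ ε > 0, ∃ k, ∃ g : X → ℝ, Measurable g ∧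
      (∀ᵐ x ∂m, x ∉ A k → g x = 0) ∧ energyOne m ν (u - g) < ε) :
    IsNest (jumpDomain m ν) (jumpForm m ν) A where
  isClosed := hA
  mono := hmono
  dense := by
    refine h.isFormDense (Set.iUnion_subset fun k u hu => hu.1) fun u hu ε hε => ?_
    obtain ⟨k, g, hgm, hg, hug⟩ := hd u hu (min ε 1) (lt_min hε one_pos)
    have hgE := h.hasFiniteEnergy_of_sub_lt_top hu hgm
      (hug.trans ((min_le_right _ _).trans_lt ENNReal.one_lt_top))
    refine ⟨hgE.memLp.toLp g, Set.mem_iUnion.2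
      ⟨k, h.toLp_mem_jumpDomain hgE.memLp hgE.lt_top, ?_⟩, ?_⟩
    · filter_upwards [hgE.memLp.coeFn_toLp, hg] with x h1 h2 hx
      rw [h1, h2 hx]
    · rw [h.energyOne_congr ((EventuallyEq.refl _ u).sub hgE.memLp.coeFn_toLp)]
      exact hug.trans_le (min_le_left _ _)

theorem energyOne_sub_eq (h : HasACMarginals m ν) {u v : Lp ℝ 2 m}
    (hu : u ∈ jumpDomain m ν) (hv : v ∈ jumpDomain m ν) :
    energyOne m ν (u - v) =
      ENNReal.ofReal (‖h.incrementLp hu - h.incrementLp hv‖ ^ 2) +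
        ENNReal.ofReal (‖u - v‖ ^ 2) := by
  rw [← h.energyOne_congr (Lp.coeFn_sub u v), energyOne, h.lintegralSq_increment_sub hu hv,
    lintegralSq_coe]

theorem exists_isQuasiContinuousVersion [TopologicalSpace X] (h : HasACMarginals m ν)
    {g f : X → ℝ} (hg : HasFiniteEnergy m ν g) (hgf : g =ᵐ[m] f) {A : ℕ → Set X}
    (hA : IsNest (jumpDomain m ν) (jumpForm m ν) A) (hf : ∀ k, ContinuousOn f (A k)) :
    ∃ u ∈ jumpDomain m ν, u =ᵐ[m] g ∧
      IsQuasiContinuousVersion (jumpDomain m ν) (jumpForm m ν) u f :=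
  ⟨hg.memLp.toLp g, h.toLp_mem_jumpDomain hg.memLp hg.lt_top, hg.memLp.coeFn_toLp,
    hg.memLp.coeFn_toLp.trans hgf, A, hA, hf⟩

theorem exists_countable_dense [MeasurableSpace.CountablyGenerated X] [SigmaFinite m] [SFinite ν]
    (h : HasACMarginals m ν) {S : Set (X → ℝ)} (hne : S.Nonempty)
    (hS : ∀ u ∈ S, HasFiniteEnergy m ν u) :
    ∃ w : ℕ → X → ℝ, (∀ i, w i ∈ S) ∧
      ∀ u ∈ S, ∀ ε > 0, ∃ i, energyOne m ν (u - w i) < ε := by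
  have : Fact ((2 : ℝ≥0∞) ≠ ∞) := ⟨by simp⟩
  have hmem (u : S) := h.toLp_mem_jumpDomain (hS u u.2).memLp (hS u u.2).lt_top
  let T (u : S) : Lp ℝ 2 ν × Lp ℝ 2 m := (h.incrementLp (hmem u), (hS u u.2).memLp.toLp _)
  have hT (u v : S) : energyOne m ν (u - v) =
      ENNReal.ofReal (‖(T u).1 - (T v).1‖ ^ 2) + ENNReal.ofReal (‖(T u).2 - (T v).2‖ ^ 2) := by
    rw [← h.energyOne_sub_eq (hmem u) (hmem v)]
    exact h.energyOne_congr
      ((hS u u.2).memLp.coeFn_toLp.symm.sub (hS v v.2).memLp.coeFn_toLp.symm)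
  have : Nonempty (Set.range T) := hne.to_subtype.map (Set.rangeFactorization T)
  obtain ⟨s, hs⟩ := TopologicalSpace.exists_dense_seq (Set.range T)
  choose w hw using fun i => (s i).2
  refine ⟨fun i => w i, fun i => (w i).2, fun u hu ε hε => ?_⟩
  have := ENNReal.continuous_ofReal
  have hcont : ContinuousAt (fun q : Set.range T =>
      ENNReal.ofReal (‖(T ⟨u, hu⟩).1 - q.1.1‖ ^ 2) +
        ENNReal.ofReal (‖(T ⟨u, hu⟩).2 - q.1.2‖ ^ 2)) ⟨T ⟨u, hu⟩, Set.mem_range_self _⟩ := by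
    fun_prop
  obtain ⟨_, hi, i, rfl⟩ := mem_closure_iff_nhds.1 (hs _) _
    (hcont.preimage_mem_nhds (Iio_mem_nhds (by simpa using hε)))
  refine ⟨i, ?_⟩
  rw [hT ⟨u, hu⟩ (w i), hw i]
  exact hi

end HasACMarginals

end Density

end JumpMeasure

section Jensen

variable {X Y : Type*} [MeasurableSpace X] [MeasurableSpace Y] {P : Measure Y}
  [IsProbabilityMeasure P] {g : Y → X → ℝ}

theorem ofReal_integral_sq_le {f : Y → ℝ} (hf : AEStronglyMeasurable f P) :
    ENNReal.ofReal ((∫ y, f y ∂P) ^ 2) ≤ lintegralSq P f := by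
  rw [lintegralSq_eq_eLpNorm_sq, ← sq_abs, ENNReal.ofReal_pow (abs_nonneg _),
    ← Real.norm_eq_abs, ofReal_norm]
  gcongr
  refine (enorm_integral_le_lintegral_enorm f).trans ?_
  rw [← eLpNorm_one_eq_lintegral_enorm]
  exact eLpNorm_le_eLpNorm_of_exponent_le (by norm_num) hf

theorem lintegralSq_integral_le {μ : Measure X} [SFinite μ]
    (hg : Measurable (Function.uncurry g)) :
    lintegralSq μ (fun x => ∫ y, g y x ∂P) ≤ ∫⁻ y, lintegralSq μ (g y) ∂P := by
  have hsq : Measurable (Function.uncurry fun y x => ENNReal.ofReal (g y x ^ 2)) :=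
    (hg.pow_const 2).ennreal_ofReal
  simp only [lintegralSq]
  rw [lintegral_lintegral_swap hsq.aemeasurable]
  exact lintegral_mono fun x => ofReal_integral_sq_le
    (hg.comp measurable_prodMk_right).aestronglyMeasurable

theorem energyOne_integral_le {m : Measure X} {ν : Measure (X × X)} [SFinite m] [SFinite ν]
    (hg : Measurable (Function.uncurry g)) (hi : ∀ x, Integrable (fun y => g y x) P) :
    energyOne m ν (fun x => ∫ y, g y x ∂P) ≤ ∫⁻ y, energyOne m ν (g y) ∂P := by
  have hincr : increment (fun x => ∫ y, g y x ∂P) = fun p => ∫ y, increment (g y) p ∂P :=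
    funext fun p => (integral_sub (hi p.1) (hi p.2)).symm
  have hmeas : Measurable (Function.uncurry fun y => increment (g y)) := by
    have h1 : Measurable fun q : Y × X × X => g q.1 q.2.1 :=
      hg.comp (measurable_fst.prodMk measurable_snd.fst)
    have h2 : Measurable fun q : Y × X × X => g q.1 q.2.2 :=
      hg.comp (measurable_fst.prodMk measurable_snd.snd)
    exact h1.sub h2
  have hm : Measurable fun y => lintegralSq m (g y) :=
    (hg.pow_const 2).ennreal_ofReal.lintegral_prod_right'
  simp only [energyOne, hincr]
  rw [lintegral_add_right _ hm]
  exact add_le_add (lintegralSq_integral_le hmeas) (lintegralSq_integral_le hg)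

end Jensen

section BumpLaw

variable {E : Type*} [NormedAddCommGroup E] [NormedSpace ℝ E] [HasContDiffBump E]
  [MeasurableSpace E] [BorelSpace E]

/-- The probability measure whose density is a normalized bump function centred at `0`; averaging
translates against it is mollification. -/
def bumpLaw (μ : Measure E) (φ : ContDiffBump (0 : E)) : Measure E :=
  μ.withDensity fun t => ENNReal.ofReal (φ.normed μ t)

variable {μ : Measure E} (φ : ContDiffBump (0 : E)) {u : E → ℝ}

theorem measurable_ofReal_normed : Measurable fun t => ENNReal.ofReal (φ.normed μ t) :=
  φ.continuous_normed.measurable.ennreal_ofReal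

variable [FiniteDimensional ℝ E] [μ.IsAddHaarMeasure]

instance : IsProbabilityMeasure (bumpLaw μ φ) where
  measure_univ := by
    rw [bumpLaw, withDensity_apply _ .univ, Measure.restrict_univ,
      ← ofReal_integral_eq_lintegral_ofReal φ.integrable_normed (ae_of_all _ φ.nonneg_normed),
      φ.integral_normed, ENNReal.ofReal_one]

theorem ae_bumpLaw_norm_lt : ∀ᵐ t ∂bumpLaw μ φ, ‖t‖ < φ.rOut := by
  rw [bumpLaw, ae_withDensity_iff (measurable_ofReal_normed φ)]
  refine ae_of_all _ fun t ht => ?_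
  have hsupp : t ∈ Function.support (φ.normed μ) := fun h => ht (by rw [h, ENNReal.ofReal_zero])
  rwa [φ.support_normed_eq, mem_ball_zero_iff] at hsupp

theorem integrable_bumpLaw (hu : LocallyIntegrable u μ) (x : E) :
    Integrable (fun t => u (x - t)) (bumpLaw μ φ) := by
  rw [bumpLaw, integrable_withDensity_iff_integrable_smul' (measurable_ofReal_normed φ)
    (ae_of_all _ fun _ => ENNReal.ofReal_lt_top)]
  simpa only [ENNReal.toReal_ofReal (φ.nonneg_normed _), ConvolutionExistsAt,
    ContinuousLinearMap.lsmul_apply] using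
    φ.hasCompactSupport_normed.convolutionExists_left (ContinuousLinearMap.lsmul ℝ ℝ)
      φ.continuous_normed hu x

theorem continuous_integral_bumpLaw (hu : LocallyIntegrable u μ) :
    Continuous fun x => ∫ t, u (x - t) ∂bumpLaw μ φ := by
  have hconv := φ.hasCompactSupport_normed (μ := μ).continuous_convolution_left
    (ContinuousLinearMap.lsmul ℝ ℝ) φ.continuous_normed hu
  refine hconv.congr fun x => ?_
  rw [bumpLaw, integral_withDensity_eq_integral_toReal_smul (measurable_ofReal_normed φ)
    (ae_of_all _ fun _ => ENNReal.ofReal_lt_top)]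
  simp only [convolution, ContinuousLinearMap.lsmul_apply,
    ENNReal.toReal_ofReal (φ.nonneg_normed _)]

end BumpLaw

theorem tendsto_lintegralSq_translate {G : Type*} [AddGroup G] [TopologicalSpace G]
    [IsTopologicalAddGroup G] [R1Space G] [MeasurableSpace G] [BorelSpace G] {μ : Measure G}
    [IsLocallyFiniteMeasure μ] [μ.InnerRegularCompactLTTop] [μ.IsAddLeftInvariant] {f : G → ℝ}
    (hf : MemLp f 2 μ) :
    Tendsto (fun t => lintegralSq μ fun x => f (t + x) - f x) (𝓝 0) (𝓝 0) := by
  have : Fact ((2 : ℝ≥0∞) ≠ ∞) := ⟨by simp⟩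
  have hcont : Continuous fun t : G => DomAddAct.mk t +ᵥ hf.toLp f :=
    DomAddAct.continuous_mk.vadd continuous_const
  have hlim := ENNReal.Tendsto.pow (n := 2)
    ((Lp.tendsto_Lp_iff_tendsto_eLpNorm' _ _).1 (hcont.tendsto 0))
  refine (hlim.congr fun t => ?_).trans (le_of_eq (by simp))
  rw [lintegralSq_eq_eLpNorm_sq]
  congr 1
  refine eLpNorm_congr_ae ?_
  rw [DomAddAct.mk_vadd_toLp, DomAddAct.mk_zero, zero_vadd]
  filter_upwards [(hf.comp_measurePreserving (measurePreserving_vadd t μ)).coeFn_toLp,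
    hf.coeFn_toLp] with x hx1 hx2
  rw [Pi.sub_apply, hx2]
  exact congrArg (· - f x) hx1

theorem exists_two_mul_add_lt {ε : ℝ≥0∞} (hε : 0 < ε) :
    ∃ η > 0, ∀ a b : ℝ≥0∞, a < η → b < η → 2 * (a + b) < ε := by
  refine ⟨ε / 2 / 2, ENNReal.half_pos (ENNReal.half_pos hε.ne').ne', fun a b ha hb => ?_⟩
  rw [mul_comm, ← ENNReal.lt_div_iff_mul_lt (by simp) (by simp)]
  exact (ENNReal.add_lt_add ha hb).trans_eq (ENNReal.add_halves _)

theorem tendsto_zero_of_tendsto_ofReal_sq {ι : Type*} {l : Filter ι} {f : ι → ℝ}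
    (h : Tendsto (fun n => ENNReal.ofReal (f n ^ 2)) l (𝓝 0)) : Tendsto f l (𝓝 0) := by
  have hsq : Tendsto (fun n => f n ^ 2) l (𝓝 0) := by
    simpa [Function.comp_def, ENNReal.toReal_ofReal (sq_nonneg _)] using
      (ENNReal.continuousAt_toReal ENNReal.zero_ne_top).tendsto.comp h
  rw [tendsto_zero_iff_abs_tendsto_zero]
  simpa [Function.comp_def, Real.sqrt_sq_eq_abs] using (Real.continuous_sqrt.tendsto 0).comp hsq

theorem ofReal_iSup_sub_iSup_sq_le {ι : Type*} [Nonempty ι] {a b : ι → ℝ}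
    (ha : BddAbove (Set.range a)) (hb : BddAbove (Set.range b)) :
    ENNReal.ofReal (((⨆ i, a i) - ⨆ i, b i) ^ 2) ≤ ∑' i, ENNReal.ofReal ((a i - b i) ^ 2) := by
  set S := ∑' i, ENNReal.ofReal ((a i - b i) ^ 2)
  rcases eq_or_ne S ∞ with h | h
  · exact h ▸ le_top
  have habs (i) : |a i - b i| ≤ √S.toReal :=
    Real.abs_le_sqrt ((ENNReal.ofReal_le_iff_le_toReal h).1 (ENNReal.le_tsum i))
  have hab : (⨆ i, a i) ≤ (⨆ i, b i) + √S.toReal := ciSup_le fun i => by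
    linarith [(abs_le.1 (habs i)).2, le_ciSup hb i]
  have hba : (⨆ i, b i) ≤ (⨆ i, a i) + √S.toReal := ciSup_le fun i => by
    linarith [(abs_le.1 (habs i)).1, le_ciSup ha i]
  rw [ENNReal.ofReal_le_iff_le_toReal h, ← Real.sq_sqrt (ENNReal.toReal_nonneg (a := S))]
  exact sq_le_sq' (by linarith) (by linarith)

section JumpMeasure

variable {X : Type*} [MeasurableSpace X] {m : Measure X} {ν : Measure (X × X)}

section Limits

theorem tsum_lintegralSq {ι : Type*} [Countable ι] {f : ι → X → ℝ}
    (hf : ∀ i, Measurable (f i)) :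
    ∑' i, lintegralSq m (f i) = ∫⁻ x, ∑' i, ENNReal.ofReal (f i x ^ 2) ∂m :=
  (lintegral_tsum fun i => by have := hf i; fun_prop).symm

theorem ae_tsum_ofReal_sq_lt_top {ι : Type*} [Countable ι] {f : ι → X → ℝ}
    (hf : ∀ i, Measurable (f i)) (h : ∑' i, lintegralSq m (f i) ≠ ∞) :
    ∀ᵐ x ∂m, ∑' i, ENNReal.ofReal (f i x ^ 2) < ∞ := by
  rw [tsum_lintegralSq hf] at h
  exact ae_lt_top' (AEMeasurable.tsum fun i => by have := hf i; fun_prop) h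

theorem energyOne_const_smul (c : ℝ) (u : X → ℝ) :
    energyOne m ν (c • u) = ENNReal.ofReal (c ^ 2) * energyOne m ν u := by
  rw [energyOne, energyOne, map_smul, mul_add]
  exact congrArg₂ _ (lintegralSq_const_mul c _) (lintegralSq_const_mul c u)

theorem energyOne_iSup_le {ι : Type*} [Countable ι] [Nonempty ι] {b : ι → X → ℝ}
    (hb : ∀ i, Measurable (b i)) (hbd : ∀ x, BddAbove (Set.range fun i => b i x)) :
    energyOne m ν (fun x => ⨆ i, b i x) ≤ ∑' i, energyOne m ν (b i) := by
  simp only [energyOne]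
  rw [ENNReal.tsum_add, tsum_lintegralSq hb, tsum_lintegralSq fun i => ?_]
  · refine add_le_add (lintegral_mono fun p => ofReal_iSup_sub_iSup_sq_le (hbd p.1) (hbd p.2))
      (lintegral_mono fun x => ?_)
    simpa using ofReal_iSup_sub_iSup_sq_le (hbd x) (b := fun _ => 0) (by simp)
  · exact ((hb i).comp measurable_fst).sub ((hb i).comp measurable_snd)

theorem HasACMarginals.tendsto_energyOne_mul (h : HasACMarginals m ν) {v : X → ℝ} {M : ℝ}
    (hM : ∀ x, |v x| ≤ M) (hv : HasFiniteEnergy m ν v) {e : ℕ → X → ℝ}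
    (he : ∀ k, Measurable (e k)) (he1 : ∀ k x, |e k x| ≤ 1)
    (he0 : ∀ᵐ x ∂m, Tendsto (fun k => e k x) atTop (𝓝 0))
    (hen : Tendsto (fun k => lintegralSq ν (increment (e k))) atTop (𝓝 0)) :
    Tendsto (fun k => energyOne m ν (e k * v)) atTop (𝓝 0) := by
  have hvm := hv.measurable
  have hfin := ENNReal.add_lt_top.1 hv.lt_top
  have hle (k : ℕ) (x : X) (t : ℝ) : |e k x * t| ≤ |t| := by
    rw [abs_mul]
    exact mul_le_of_le_one_left (abs_nonneg _) (he1 k x)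
  have hL2 : Tendsto (fun k => lintegralSq m (e k * v)) atTop (𝓝 0) :=
    tendsto_lintegralSq_zero_of_dominated (fun k => ((he k).mul hvm).aestronglyMeasurable)
      hfin.2 (fun k => ae_of_all _ fun x => hle k x _)
      (he0.mono fun x hx => by simpa using hx.mul_const (v x))
  have hleft : Tendsto (fun k => lintegralSq ν fun p => e k p.1 * increment v p)
      atTop (𝓝 0) := by
    refine tendsto_lintegralSq_zero_of_dominated (fun k => ?_) hfin.1
      (fun k => ae_of_all _ fun p => hle k p.1 _)
      ((h.fst.ae he0).mono fun p hp => by simpa using hp.mul_const (increment v p))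
    exact ((he k).comp measurable_fst).aestronglyMeasurable.mul
      (h.aestronglyMeasurable_increment hvm.aestronglyMeasurable)
  have hright : Tendsto (fun k => lintegralSq ν fun p : X × X => v p.2 * increment (e k) p)
      atTop (𝓝 0) := by
    refine tendsto_of_tendsto_of_tendsto_of_le_of_le tendsto_const_nhds ?_ (fun _ => zero_le)
      fun k => lintegralSq_mul_le_of_abs_le (f := fun p : X × X => v p.2) fun p => hM p.2
    simpa using ENNReal.Tendsto.const_mul hen (Or.inr ENNReal.ofReal_ne_top)
  have hsum : Tendsto (fun k => 2 * (lintegralSq ν (fun p => e k p.1 * increment v p) +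
      lintegralSq ν fun p => v p.2 * increment (e k) p)) atTop (𝓝 0) := by
    simpa using ENNReal.Tendsto.const_mul (hleft.add hright) (Or.inr ENNReal.ofNat_ne_top)
  have hincr : Tendsto (fun k => lintegralSq ν (increment (e k * v))) atTop (𝓝 0) :=
    tendsto_of_tendsto_of_tendsto_of_le_of_le tendsto_const_nhds hsum (fun _ => zero_le)
      fun k => lintegralSq_increment_mul_le (he k) hvm
  simpa [energyOne] using hincr.add hL2

theorem HasACMarginals.tendsto_energyOne_sub_comp (h : HasACMarginals m ν) {u : X → ℝ}
    (hu : HasFiniteEnergy m ν u) {φ : ℕ → ℝ → ℝ} (hφ : ∀ n, LipschitzWith 1 (φ n))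
    (h0 : ∀ n, φ n 0 = 0) (hlim : ∀ t, Tendsto (fun n => φ n t) atTop (𝓝 t)) :
    Tendsto (fun n => energyOne m ν (u - φ n ∘ u)) atTop (𝓝 0) := by
  have hmeas (n) : Measurable (u - φ n ∘ u) :=
    hu.measurable.sub ((hφ n).continuous.measurable.comp hu.measurable)
  have htend (x) : Tendsto (fun n => (u - φ n ∘ u) x) atTop (𝓝 0) := by
    simpa using (hlim (u x)).const_sub (u x)
  have hfin : lintegralSq ν (increment ((2 : ℝ) • u)) < ∞ ∧ lintegralSq m ((2 : ℝ) • u) < ∞ := by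
    rw [← ENNReal.add_lt_top, ← energyOne, energyOne_const_smul]
    exact ENNReal.mul_lt_top ENNReal.ofReal_lt_top hu.lt_top
  have hle {s t : ℝ} (hst : |s| ≤ |t|) : |t - s| ≤ |2 * t| := by
    rw [abs_mul, abs_two, two_mul]
    exact (abs_sub _ _).trans (add_le_add_right hst _)
  have hL2 : Tendsto (fun n => lintegralSq m (u - φ n ∘ u)) atTop (𝓝 0) :=
    tendsto_lintegralSq_zero_of_dominated (fun n => (hmeas n).aestronglyMeasurable) hfin.2
      (fun n => ae_of_all _ fun x => hle (by simpa [h0] using (hφ n).dist_le_mul (u x) 0))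
      (ae_of_all _ htend)
  have hincr : Tendsto (fun n => lintegralSq ν (increment (u - φ n ∘ u))) atTop (𝓝 0) := by
    refine tendsto_lintegralSq_zero_of_dominated
      (fun n => h.aestronglyMeasurable_increment (hmeas n).aestronglyMeasurable) hfin.1
      (fun n => ae_of_all _ fun p => ?_)
      (ae_of_all _ fun p => by
        simpa only [increment_apply, sub_zero] using (htend p.1).sub (htend p.2))
    rw [map_sub, map_smul]
    exact hle (abs_increment_comp_le (hφ n) u p)
  simpa [energyOne] using hincr.add hL2

end Limits

section Clamp

/-- Truncation of a real number at height `R`. -/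
def clamp (R t : ℝ) : ℝ := max (-R) (min R t)

theorem lipschitzWith_clamp (R : ℝ) : LipschitzWith 1 (clamp R) :=
  (LipschitzWith.id.const_min R).const_max (-R)

theorem abs_clamp_le {R : ℝ} (hR : 0 ≤ R) (t : ℝ) : |clamp R t| ≤ R :=
  abs_le.2 ⟨le_max_left _ _, max_le (neg_le_self hR) (min_le_left _ _)⟩

theorem clamp_of_abs_le {R t : ℝ} (ht : |t| ≤ R) : clamp R t = t := by
  rw [clamp, min_eq_right (abs_le.1 ht).2, max_eq_right (abs_le.1 ht).1]

theorem lipschitzWith_sub_clamp (c : ℝ) : LipschitzWith 1 fun t => t - clamp c t := by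
  refine LipschitzWith.of_dist_le_mul fun s t => ?_
  simp only [Real.dist_eq, clamp, NNReal.coe_one, one_mul]
  grind

/-- The function that truncates at height `n + 1` and moves by `1 / (n + 1)` towards zero. -/
def softClamp (n : ℕ) (t : ℝ) : ℝ := clamp (n + 1) (t - clamp (1 / (n + 1)) t)

theorem softClamp_of_abs_le {n : ℕ} {t : ℝ} (ht : |t| ≤ 1 / (n + 1)) : softClamp n t = 0 := by
  rw [softClamp, clamp_of_abs_le ht, sub_self, clamp_of_abs_le (by rw [abs_zero]; positivity)]

theorem softClamp_zero (n : ℕ) : softClamp n 0 = 0 :=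
  softClamp_of_abs_le (by rw [abs_zero]; positivity)

theorem abs_softClamp_le (n : ℕ) (t : ℝ) : |softClamp n t| ≤ n + 1 :=
  abs_clamp_le (by positivity) _

theorem lipschitzWith_softClamp (n : ℕ) : LipschitzWith 1 (softClamp n) :=
  ((lipschitzWith_clamp _).comp (lipschitzWith_sub_clamp _)).weaken (mul_one 1).le

theorem tendsto_softClamp (t : ℝ) : Tendsto (fun n => softClamp n t) atTop (𝓝 t) := by
  refine tendsto_iff_dist_tendsto_zero.2 (squeeze_zero' (Eventually.of_forall fun _ => dist_nonneg)
    ?_ tendsto_one_div_add_atTop_nhds_zero_nat)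
  filter_upwards [eventually_ge_atTop ⌈|t|⌉₊] with n hn
  have htn : |t| ≤ n := (Nat.le_ceil _).trans (by exact_mod_cast hn)
  have hc : (0 : ℝ) ≤ 1 / (n + 1) := by positivity
  have hshrink : |t - clamp (1 / (n + 1)) t| ≤ |t| := by
    simpa only [Real.dist_eq, clamp_of_abs_le (abs_zero.trans_le hc), sub_zero, NNReal.coe_one,
      one_mul] using (lipschitzWith_sub_clamp (1 / ((n : ℝ) + 1))).dist_le_mul t 0
  rw [softClamp, clamp_of_abs_le (by linarith), dist_comm, Real.dist_eq, sub_sub_cancel]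
  exact abs_clamp_le hc t

end Clamp

end JumpMeasure

section QuasiContinuity

variable {X : Type*}

section FastConvergence

/-- The points at which, from index `k` on, the `n`-th and the next term of `ψ` differ by at most
`2⁻ⁿ`. -/
def fastConvergenceSet (ψ : ℕ → X → ℝ) (k : ℕ) : Set X :=
  {x | ∀ n ≥ k, |2 ^ n * (ψ (n + 1) x - ψ n x)| ≤ 1}

theorem monotone_fastConvergenceSet (ψ : ℕ → X → ℝ) : Monotone (fastConvergenceSet ψ) :=
  fun _ _ hkl _ hx n hn => hx n (hkl.trans hn)

theorem dist_le_of_mem_fastConvergenceSet {ψ : ℕ → X → ℝ} {k : ℕ} {x : X}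
    (hx : x ∈ fastConvergenceSet ψ k) (n : ℕ) :
    dist (ψ (n + k) x) (ψ (n + 1 + k) x) ≤ 2 / 2 / 2 ^ n := by
  have hdist := hx (n + k) le_add_self
  rw [abs_mul, abs_pow, abs_two] at hdist
  rw [dist_comm, Real.dist_eq, div_self two_ne_zero, le_div_iff₀ (by positivity), mul_comm,
    add_right_comm]
  refine le_trans ?_ hdist
  gcongr
  · exact one_le_two
  · exact le_self_add

theorem tendsto_limUnder_of_mem_fastConvergenceSet {ψ : ℕ → X → ℝ} {k : ℕ} {x : X}
    (hx : x ∈ fastConvergenceSet ψ k) :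
    Tendsto (fun n => ψ (n + k) x) atTop (𝓝 (limUnder atTop fun n => ψ n x)) := by
  obtain ⟨a, ha⟩ := cauchySeq_tendsto_of_complete
    (cauchySeq_of_le_geometric_two (dist_le_of_mem_fastConvergenceSet hx))
  rwa [((tendsto_add_atTop_iff_nat (f := fun n => ψ n x) k).1 ha).limUnder_eq]

/-- The `n`-th increment of `ψ` in absolute value, scaled by `2ⁿ` and capped at `1`; it equals `1`
where `n` witnesses that a point is not in `fastConvergenceSet ψ k`. -/
def cappedIncrement (ψ : ℕ → X → ℝ) (n : ℕ) (x : X) : ℝ := min 1 |2 ^ n * (ψ (n + 1) x - ψ n x)|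

theorem cappedIncrement_mem_Icc (ψ : ℕ → X → ℝ) (n : ℕ) (x : X) :
    cappedIncrement ψ n x ∈ Set.Icc 0 1 :=
  ⟨le_min zero_le_one (abs_nonneg _), min_le_left _ _⟩

theorem exists_cappedIncrement_eq_one {ψ : ℕ → X → ℝ} {k : ℕ} {x : X}
    (hx : x ∉ fastConvergenceSet ψ k) : ∃ n ≥ k, cappedIncrement ψ n x = 1 := by
  simp only [fastConvergenceSet, Set.mem_ofPred_eq, not_forall, not_le] at hx
  obtain ⟨n, hn, hlt⟩ := hx
  exact ⟨n, hn, min_eq_left hlt.le⟩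

variable [TopologicalSpace X]

theorem isClosed_fastConvergenceSet {ψ : ℕ → X → ℝ} (hψ : ∀ n, Continuous (ψ n)) (k : ℕ) :
    IsClosed (fastConvergenceSet ψ k) := by
  simp only [fastConvergenceSet, Set.ofPred_forall]
  exact isClosed_iInter fun n => isClosed_iInter fun _ =>
    isClosed_le (continuous_const.mul ((hψ _).sub (hψ n))).abs continuous_const

theorem continuousOn_limUnder_fastConvergenceSet {ψ : ℕ → X → ℝ} (hψ : ∀ n, Continuous (ψ n))
    (k : ℕ) :
    ContinuousOn (fun x => limUnder atTop fun n => ψ n x) (fastConvergenceSet ψ k) := by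
  refine TendstoUniformlyOn.continuousOn (F := fun n => ψ (n + k)) (p := atTop) ?_
    (Frequently.of_forall fun n => (hψ _).continuousOn)
  refine Metric.tendstoUniformlyOn_iff.2 fun ε hε => ?_
  have hpow : Tendsto (fun n : ℕ => (2 : ℝ) / 2 ^ n) atTop (𝓝 0) :=
    tendsto_const_nhds.div_atTop (tendsto_pow_atTop_atTop_of_one_lt one_lt_two)
  filter_upwards [hpow.eventually_lt_const hε] with n hn x hx
  rw [dist_comm]
  exact (dist_le_of_le_geometric_two_of_tendsto (dist_le_of_mem_fastConvergenceSet hx)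
    (tendsto_limUnder_of_mem_fastConvergenceSet hx) n).trans_lt hn

variable [MeasurableSpace X] [BorelSpace X] {m : Measure X} {ν : Measure (X × X)}

theorem measurable_cappedIncrement {ψ : ℕ → X → ℝ} (hψ : ∀ n, Continuous (ψ n))
    (n : ℕ) : Measurable (cappedIncrement ψ n) :=
  (continuous_const.min (continuous_const.mul ((hψ _).sub (hψ n))).abs).measurable

theorem HasACMarginals.energyOne_cappedIncrement_le (h : HasACMarginals m ν)
    {w : X → ℝ} (hw : Measurable w) {ψ : ℕ → X → ℝ} (hψ : ∀ n, Continuous (ψ n)) {δ : ℕ → ℝ≥0∞}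
    (hδ : ∀ n, 4 ^ n * energyOne m ν (w - ψ n) ≤ δ n) (n : ℕ) :
    energyOne m ν (cappedIncrement ψ n) ≤ 2 * (δ (n + 1) + δ n) := by
  have hcap : LipschitzWith 1 fun t : ℝ => min 1 |t| := by
    refine LipschitzWith.of_dist_le_mul fun s t => ?_
    rw [NNReal.coe_one, one_mul]
    exact (abs_min_sub_min_le_max 1 |s| 1 |t|).trans
      (by simpa [Real.dist_eq] using abs_abs_sub_abs_le_abs_sub s t)
  have hpow : ENNReal.ofReal ((2 ^ n) ^ 2) = 4 ^ n := by
    rw [← pow_mul, mul_comm, pow_mul, ENNReal.ofReal_pow (by positivity)]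
    norm_num
  have hsucc : (4 : ℝ≥0∞) ^ n * energyOne m ν (w - ψ (n + 1)) ≤ δ (n + 1) := by
    refine le_trans ?_ (hδ (n + 1))
    gcongr
    · norm_num
    · exact n.le_succ
  calc energyOne m ν (cappedIncrement ψ n)
      ≤ energyOne m ν ((2 ^ n : ℝ) • (ψ (n + 1) - ψ n)) := energyOne_comp_le hcap (by simp) _
    _ = 4 ^ n * energyOne m ν (ψ (n + 1) - ψ n) := by rw [energyOne_const_smul, hpow]
    _ ≤ 4 ^ n * (2 * (energyOne m ν (w - ψ (n + 1)) + energyOne m ν (w - ψ n))) := by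
        rw [energyOne_sub_comm w (ψ (n + 1))]
        gcongr
        exact h.energyOne_sub_le w (hψ _).measurable.aestronglyMeasurable hw.aestronglyMeasurable
    _ = 2 * (4 ^ n * energyOne m ν (w - ψ (n + 1)) + 4 ^ n * energyOne m ν (w - ψ n)) := by ring
    _ ≤ 2 * (δ (n + 1) + δ n) := by
        gcongr
        exact hδ n

end FastConvergence

section CutoffNest

variable [MeasurableSpace X] {m : Measure X} {ν : Measure (X × X)}

theorem limUnder_ae_eq_of_tsum_energyOne {w : X → ℝ} (hw : Measurable w) {ψ : ℕ → X → ℝ}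
    (hψ : ∀ n, Measurable (ψ n)) (hsum : ∑' n, energyOne m ν (w - ψ n) ≠ ∞) :
    (fun x => limUnder atTop fun n => ψ n x) =ᵐ[m] w := by
  have hL2 : ∑' n, lintegralSq m (w - ψ n) ≠ ∞ :=
    ne_top_of_le_ne_top hsum (ENNReal.tsum_le_tsum fun n => le_add_self)
  filter_upwards [ae_tsum_ofReal_sq_lt_top (fun n => hw.sub (hψ n)) hL2] with x hx
  have hlim := tendsto_zero_of_tendsto_ofReal_sq
    (ENNReal.tendsto_atTop_zero_of_tsum_ne_top hx.ne)
  refine Tendsto.limUnder_eq ?_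
  simpa using hlim.const_sub (w x)

variable [TopologicalSpace X]

/-- `B` is an increasing sequence of closed sets and `e k` are cutoff functions that equal `1` off
`B k` and whose energy tends to `0`, so that the complement of `B k` has small capacity. -/
structure IsCutoffNest (m : Measure X) (ν : Measure (X × X)) (B : ℕ → Set X) (e : ℕ → X → ℝ) :
    Prop where
  isClosed : ∀ k, IsClosed (B k)
  mono : Monotone B
  measurable : ∀ k, Measurable (e k)
  mem_Icc : ∀ k x, e k x ∈ Set.Icc 0 1
  eq_one : ∀ k, ∀ x ∉ B k, e k x = 1
  tendsto : ∀ᵐ x ∂m, Tendsto (fun k => e k x) atTop (𝓝 0)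
  tendsto_energy : Tendsto (fun k => lintegralSq ν (increment (e k))) atTop (𝓝 0)

/-- The supremum of the terms of `b` from index `k` on. -/
def tailSup (b : ℕ → X → ℝ) (k : ℕ) (x : X) : ℝ := ⨆ n, b (n + k) x

theorem isCutoffNest_tailSup {B : ℕ → Set X} (hB : ∀ k, IsClosed (B k)) (hmono : Monotone B)
    {b : ℕ → X → ℝ} (hb : ∀ n, Measurable (b n)) (hb01 : ∀ n x, b n x ∈ Set.Icc 0 1)
    (hone : ∀ k, ∀ x ∉ B k, ∃ n ≥ k, b n x = 1) (hsum : ∑' n, energyOne m ν (b n) ≠ ∞) :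
    IsCutoffNest m ν B (tailSup b) := by
  have hbdd (k x) : BddAbove (Set.range fun n => b (n + k) x) :=
    ⟨1, Set.forall_mem_range.2 fun n => (hb01 _ x).2⟩
  refine ⟨hB, hmono, fun k => Measurable.iSup fun n => hb _, fun k x => ⟨?_, ?_⟩,
    fun k x hx => ?_, ?_, ?_⟩
  · exact Real.iSup_nonneg fun n => (hb01 _ x).1
  · exact ciSup_le fun n => (hb01 _ x).2
  · obtain ⟨n, hn, hnx⟩ := hone k x hx
    refine le_antisymm (ciSup_le fun n => (hb01 _ x).2) (hnx.symm.trans_le ?_)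
    simpa only [tailSup, Nat.sub_add_cancel hn] using le_ciSup (hbdd k x) (n - k)
  · have hL2 : ∑' n, lintegralSq m (b n) ≠ ∞ :=
      ne_top_of_le_ne_top hsum (ENNReal.tsum_le_tsum fun n => le_add_self)
    filter_upwards [ae_tsum_ofReal_sq_lt_top hb hL2] with x hx
    refine tendsto_zero_of_tendsto_ofReal_sq (tendsto_of_tendsto_of_tendsto_of_le_of_le
      tendsto_const_nhds (ENNReal.tendsto_sum_nat_add _ hx.ne) (fun _ => zero_le) fun k => ?_)
    simpa [tailSup] using ofReal_iSup_sub_iSup_sq_le (hbdd k x) (b := fun _ => 0) (by simp)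
  · exact tendsto_of_tendsto_of_tendsto_of_le_of_le tendsto_const_nhds
      (ENNReal.tendsto_sum_nat_add _ hsum) (fun _ => zero_le) fun k =>
        le_self_add.trans (energyOne_iSup_le (fun n => hb _) (hbdd k))

theorem HasACMarginals.exists_cutoffNest_iInter_fastConvergenceSet
    [BorelSpace X] (h : HasACMarginals m ν) {w : ℕ → X → ℝ} (hw : ∀ i, Measurable (w i))
    {ψ : ℕ → ℕ → X → ℝ} (hψ : ∀ i n, Continuous (ψ i n)) {δ : ℕ → ℕ → ℝ≥0∞}
    (hδ : ∀ i n, 4 ^ n * energyOne m ν (w i - ψ i n) ≤ δ i n) (hsum : ∑' i, ∑' n, δ i n ≠ ∞) :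
    ∃ e, IsCutoffNest m ν (fun k => ⋂ i, fastConvergenceSet (ψ i) k) e := by
  have hbdd (n x) : BddAbove (Set.range fun i => cappedIncrement (ψ i) n x) :=
    ⟨1, Set.forall_mem_range.2 fun i => (cappedIncrement_mem_Icc _ n x).2⟩
  refine ⟨_, isCutoffNest_tailSup
    (b := fun n x => ⨆ i, cappedIncrement (ψ i) n x)
    (fun k => isClosed_iInter fun i => isClosed_fastConvergenceSet (hψ i) k)
    (fun k l hkl => Set.iInter_mono fun i => monotone_fastConvergenceSet (ψ i) hkl)
    (fun n => Measurable.iSup fun i => measurable_cappedIncrement (hψ i) n)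
    (fun n x => ⟨Real.iSup_nonneg fun i => (cappedIncrement_mem_Icc _ n x).1,
      ciSup_le fun i => (cappedIncrement_mem_Icc _ n x).2⟩) (fun k x hx => ?_) ?_⟩
  · simp only [Set.mem_iInter, not_forall] at hx
    obtain ⟨i, hi⟩ := hx
    obtain ⟨n, hn, hnx⟩ := exists_cappedIncrement_eq_one hi
    exact ⟨n, hn, le_antisymm (ciSup_le fun i => (cappedIncrement_mem_Icc _ n x).2)
      (hnx.symm.trans_le (le_ciSup (hbdd n x) i))⟩
  · rw [ENNReal.tsum_comm] at hsum
    have hsucc : ∑' n, ∑' i, δ i (n + 1) ≠ ∞ := ne_top_of_le_ne_top hsum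
      (ENNReal.tsum_comp_le_tsum_of_injective (add_left_injective 1) fun n => ∑' i, δ i n)
    refine ne_top_of_le_ne_top (b := 2 * (∑' n, ∑' i, δ i (n + 1) + ∑' n, ∑' i, δ i n))
      (ENNReal.mul_ne_top (by simp) (ENNReal.add_ne_top.2 ⟨hsucc, hsum⟩)) ?_
    simp only [← ENNReal.tsum_add, ← ENNReal.tsum_mul_left]
    exact ENNReal.tsum_le_tsum fun n =>
      (energyOne_iSup_le (fun i => measurable_cappedIncrement (hψ i) n) (hbdd n)).trans
        (ENNReal.tsum_le_tsum fun i => h.energyOne_cappedIncrement_le (hw i) (hψ i) (hδ i) n)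

theorem HasACMarginals.exists_cutoffNest_continuousOn [BorelSpace X]
    (h : HasACMarginals m ν)
    {w : ℕ → X → ℝ} (hw : ∀ i, Measurable (w i))
    (happ : ∀ i, ∀ ε > 0, ∃ ψ : X → ℝ, Continuous ψ ∧ energyOne m ν (w i - ψ) ≤ ε) :
    ∃ (B : ℕ → Set X) (f e : ℕ → X → ℝ), IsCutoffNest m ν B e ∧
      (∀ i k, ContinuousOn (f i) (B k)) ∧ ∀ i, f i =ᵐ[m] w i := by
  obtain ⟨δ, hδ0, hδ⟩ := ENNReal.exists_pos_sum_of_countable' one_ne_zero (ℕ × ℕ)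
  have h4 (n : ℕ) : (4 : ℝ≥0∞) ^ n ≠ ∞ := ENNReal.pow_ne_top (by simp)
  choose ψ hψc hψ using fun i n => happ i (δ (i, n) / 4 ^ n)
    (ENNReal.div_pos (hδ0 _).ne' (h4 n))
  have hψδ (i n) : 4 ^ n * energyOne m ν (w i - ψ i n) ≤ δ (i, n) := by
    rw [mul_comm]
    exact (ENNReal.le_div_iff_mul_le (Or.inl (by simp)) (Or.inl (h4 n))).1 (hψ i n)
  have hsum : ∑' i, ∑' n, δ (i, n) ≠ ∞ := by
    rw [← ENNReal.tsum_prod' (f := δ)]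
    exact (hδ.trans ENNReal.one_lt_top).ne
  obtain ⟨e, he⟩ := h.exists_cutoffNest_iInter_fastConvergenceSet hw hψc hψδ hsum
  refine ⟨_, fun i x => limUnder atTop fun n => ψ i n x, e, he, fun i k =>
    (continuousOn_limUnder_fastConvergenceSet (hψc i) k).mono (Set.iInter_subset _ i),
    fun i => limUnder_ae_eq_of_tsum_energyOne (hw i) (fun n => (hψc i n).measurable)
      (ne_top_of_le_ne_top (ENNReal.ne_top_of_tsum_ne_top hsum i)
        (ENNReal.tsum_le_tsum fun n => (le_mul_of_one_le_left zero_le ?_).trans (hψδ i n)))⟩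
  exact one_le_pow₀ (by norm_num)

theorem IsCutoffNest.exists_energyOne_sub_mul_softClamp_lt (h : HasACMarginals m ν)
    {B : ℕ → Set X} {e : ℕ → X → ℝ} (hB : IsCutoffNest m ν B e) {u : X → ℝ}
    (hu : HasFiniteEnergy m ν u) {ε : ℝ≥0∞} (hε : 0 < ε) :
    ∃ n k, energyOne m ν (u - (1 - e k) * softClamp n ∘ u) < ε := by
  obtain ⟨η, hη, hlt⟩ := exists_two_mul_add_lt hε
  obtain ⟨n, hn⟩ := ((h.tendsto_energyOne_sub_comp hu lipschitzWith_softClamp softClamp_zero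
    tendsto_softClamp).eventually_lt_const hη).exists
  have hv := hu.comp_lipschitz (lipschitzWith_softClamp n) (softClamp_zero n)
  obtain ⟨k, hk⟩ := ((h.tendsto_energyOne_mul (fun x => abs_softClamp_le n (u x)) hv
    hB.measurable (fun k x => (abs_of_nonneg (hB.mem_Icc k x).1).trans_le (hB.mem_Icc k x).2)
    hB.tendsto hB.tendsto_energy).eventually_lt_const hη).exists
  refine ⟨n, k, lt_of_le_of_lt ?_ (hlt _ _ hn hk)⟩
  have hsplit : u - (1 - e k) * softClamp n ∘ u =
      (u - softClamp n ∘ u) + e k * softClamp n ∘ u := by ring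
  rw [hsplit]
  exact h.energyOne_add_le (hu.measurable.sub hv.measurable).aestronglyMeasurable

end CutoffNest

section NestOn

/-- The part of `B k` where one of the first functions of `f` is at least `1 / (k + 1)` in absolute
value. -/
def nonvanishingSet (B : ℕ → Set X) (f : ℕ → X → ℝ) (k : ℕ) : Set X :=
  ⋃ i ∈ Set.Iic k, B k ∩ f i ⁻¹' {t | 1 / ((k : ℝ) + 1) ≤ |t|}

theorem mem_nonvanishingSet {B : ℕ → Set X} {f : ℕ → X → ℝ} {k : ℕ} {x : X} :
    x ∈ nonvanishingSet B f k ↔ x ∈ B k ∧ ∃ i ≤ k, 1 / ((k : ℝ) + 1) ≤ |f i x| := by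
  simp only [nonvanishingSet, Set.mem_iUnion, Set.mem_Iic, Set.mem_inter_iff, Set.mem_preimage,
    Set.mem_ofPred_eq]
  tauto

theorem exists_ne_zero_of_mem_nonvanishingSet {B : ℕ → Set X} {f : ℕ → X → ℝ} {k : ℕ} {x : X}
    (hx : x ∈ nonvanishingSet B f k) : ∃ i, f i x ≠ 0 := by
  obtain ⟨-, i, -, hi⟩ := mem_nonvanishingSet.1 hx
  exact ⟨i, abs_pos.1 (lt_of_lt_of_le (by positivity) hi)⟩

theorem monotone_nonvanishingSet {B : ℕ → Set X} (hB : Monotone B) (f : ℕ → X → ℝ) :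
    Monotone (nonvanishingSet B f) := fun k l hkl x hx => by
  obtain ⟨hxB, i, hi, hle⟩ := mem_nonvanishingSet.1 hx
  refine mem_nonvanishingSet.2 ⟨hB hkl hxB, i, hi.trans hkl, le_trans ?_ hle⟩
  gcongr

theorem softClamp_eq_zero_of_notMem_nonvanishingSet {B : ℕ → Set X} {f : ℕ → X → ℝ}
    {i k n : ℕ} {x : X} (hik : i ≤ k) (hnk : n ≤ k) (hB : x ∈ B k)
    (hx : x ∉ nonvanishingSet B f k) : softClamp n (f i x) = 0 := by
  have hlt : |f i x| < 1 / ((k : ℝ) + 1) := by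
    by_contra! hle
    exact hx (mem_nonvanishingSet.2 ⟨hB, i, hik, hle⟩)
  refine softClamp_of_abs_le (hlt.le.trans ?_)
  gcongr

variable [TopologicalSpace X]

theorem isClosed_nonvanishingSet {B : ℕ → Set X} (hB : ∀ k, IsClosed (B k)) {f : ℕ → X → ℝ}
    (hf : ∀ i k, ContinuousOn (f i) (B k)) (k : ℕ) : IsClosed (nonvanishingSet B f k) :=
  (Set.finite_Iic k).isClosed_biUnion fun i _ => (hf i k).preimage_isClosed_of_isClosed (hB k)
    (isClosed_le continuous_const continuous_abs)

variable [MeasurableSpace X] {m : Measure X} {ν : Measure (X × X)}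

/-- `B` is a nest for the functions that vanish off `D`: those that also vanish a.e. off some `B k`
are dense among them. -/
structure IsNestOn (m : Measure X) (ν : Measure (X × X)) (D : Set X) (B : ℕ → Set X) : Prop where
  isClosed : ∀ k, IsClosed (B k)
  mono : Monotone B
  approx : ∀ u : X → ℝ, HasFiniteEnergy m ν u → (∀ x ∉ D, u x = 0) → ∀ ε > 0,
    ∃ k, ∃ g : X → ℝ, Measurable g ∧ (∀ x ∉ D, g x = 0) ∧ (∀ᵐ x ∂m, x ∉ B k → g x = 0) ∧
      energyOne m ν (u - g) < ε

theorem IsCutoffNest.isNestOn (h : HasACMarginals m ν) {B : ℕ → Set X} {e : ℕ → X → ℝ}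
    (hB : IsCutoffNest m ν B e) (D : Set X) : IsNestOn m ν D B where
  isClosed := hB.isClosed
  mono := hB.mono
  approx u hu h0 ε hε := by
    obtain ⟨n, k, hlt⟩ := hB.exists_energyOne_sub_mul_softClamp_lt h hu hε
    refine ⟨k, _, ?_, fun x hx => ?_, ae_of_all _ fun x hx => ?_, hlt⟩
    · exact (measurable_one.sub (hB.measurable k)).mul
        ((lipschitzWith_softClamp n).continuous.measurable.comp hu.measurable)
    · simp [h0 x hx, softClamp_zero]
    · simp [hB.eq_one k x hx]

theorem IsCutoffNest.isNestOn_nonvanishingSet (h : HasACMarginals m ν) {B : ℕ → Set X}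
    {e : ℕ → X → ℝ} (hB : IsCutoffNest m ν B e) {D : Set X} {w f : ℕ → X → ℝ}
    (hw : ∀ i, HasFiniteEnergy m ν (w i)) (hw0 : ∀ i, ∀ x ∉ D, w i x = 0)
    (hf : ∀ i k, ContinuousOn (f i) (B k)) (hfw : ∀ i, f i =ᵐ[m] w i)
    (hdense : ∀ u, HasFiniteEnergy m ν u → (∀ x ∉ D, u x = 0) → ∀ ε > 0,
      ∃ i, energyOne m ν (u - w i) < ε) :
    IsNestOn m ν D (nonvanishingSet B f) where
  isClosed := isClosed_nonvanishingSet hB.isClosed hf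
  mono := monotone_nonvanishingSet hB.mono f
  approx u hu h0 ε hε := by
    obtain ⟨η, hη, hlt⟩ := exists_two_mul_add_lt hε
    obtain ⟨i, hi⟩ := hdense u hu h0 η hη
    obtain ⟨n, k, hnk⟩ := hB.exists_energyOne_sub_mul_softClamp_lt h (hw i) hη
    obtain ⟨l, hil, hnl, hkl⟩ : ∃ l, i ≤ l ∧ n ≤ l ∧ k ≤ l :=
      ⟨max i (max n k), by simp, by simp, by simp⟩
    refine ⟨l, (1 - e k) * softClamp n ∘ w i, ?_, fun x hx => ?_, ?_,
      lt_of_le_of_lt ?_ (hlt _ _ hi hnk)⟩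
    · exact (measurable_one.sub (hB.measurable k)).mul
        ((lipschitzWith_softClamp n).continuous.measurable.comp (hw i).measurable)
    · simp [hw0 i x hx, softClamp_zero]
    · filter_upwards [hfw i] with x hfx hx
      by_cases hxk : x ∈ B k
      · have hsoft := softClamp_eq_zero_of_notMem_nonvanishingSet hil hnl (hB.mono hkl hxk) hx
        simp [← hfx, hsoft]
      · simp [hB.eq_one k x hxk]
    · exact h.energyOne_sub_le _ hu.measurable.aestronglyMeasurable
        (hw i).measurable.aestronglyMeasurable

end NestOn

end QuasiContinuity

end JumpForm

namespace NonlocalForm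

open JumpForm DirichletForm

variable {d : ℕ}

local notation:max "𝔼" n:max => EuclideanSpace ℝ (Fin n)

section Kernel

/-- The assumptions on the profile `j` of the kernel: `j(|x|) dx` is the Lévy measure of a
unimodal isotropic process on `ℝᵈ`. -/
structure IsLevyProfile (d : ℕ) (j : ℝ → ℝ) : Prop where
  pos : ∀ r, 0 < r → 0 < j r
  anti : AntitoneOn j (Set.Ioi 0)
  levy : ∫⁻ x : 𝔼 d, ENNReal.ofReal (min 1 (‖x‖ ^ 2) * j ‖x‖) < ∞

/-- The kernel `k(x, y)` as a density on pairs with values in `[0, ∞]`. -/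
def kernelDensity (j : ℝ → ℝ) (p : 𝔼 d × 𝔼 d) : ℝ≥0∞ :=
  ENNReal.ofReal (kernel j p.1 p.2)

/-- The density `(1 ∧ |x - y|²) k(x, y)`, which is integrable in each variable. -/
def levyDensity (j : ℝ → ℝ) (p : 𝔼 d × 𝔼 d) : ℝ≥0∞ :=
  ENNReal.ofReal (min 1 (‖p.1 - p.2‖ ^ 2) * kernel j p.1 p.2)

/-- The jump measure `k(x, y) dx dy` of the translation invariant form on `ℝᵈ`. -/
def jumpMeasure (j : ℝ → ℝ) : Measure (𝔼 d × 𝔼 d) :=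
  (volume.prod volume).withDensity (kernelDensity j)

/-- The jump measure of `Ê`: the jumps inside the complement of `D` are discarded. -/
def restrictedJumpMeasure (j : ℝ → ℝ) (D : Set 𝔼 d) : Measure (𝔼 d × 𝔼 d) :=
  (jumpMeasure j).restrict (Dᶜ ×ˢ Dᶜ)ᶜ

variable {j : ℝ → ℝ} {D : Set 𝔼 d}

theorem kernelDensity_swap (p : 𝔼 d × 𝔼 d) : kernelDensity j p.swap = kernelDensity j p := by
  simp only [kernelDensity, kernel, Prod.fst_swap, Prod.snd_swap, norm_sub_rev]

theorem levyDensity_swap (p : 𝔼 d × 𝔼 d) : levyDensity j p.swap = levyDensity j p := by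
  simp only [levyDensity, kernel, Prod.fst_swap, Prod.snd_swap, norm_sub_rev]

-- Monotonicity makes `j` measurable on `(0, ∞)` only; nothing is known about `j` on `(-∞, 0)`.
theorem measurable_comp_of_antitoneOn_Ioi {Y : Type*} [MeasurableSpace Y]
    (hj : AntitoneOn j (Set.Ioi 0)) {r : Y → ℝ} (hr : Measurable r) (h0 : ∀ y, 0 ≤ r y) :
    Measurable fun y => j (r y) := by
  have hexp : Antitone fun s => j (Real.exp s) := fun a b hab =>
    hj (Real.exp_pos a) (Real.exp_pos b) (Real.exp_le_exp.2 hab)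
  have hite : (fun y => j (r y)) =
      fun y => if r y = 0 then j 0 else j (Real.exp (Real.log (r y))) := by
    funext y
    split_ifs with h
    · rw [h]
    · rw [Real.exp_log (lt_of_le_of_ne (h0 y) (Ne.symm h))]
  rw [hite]
  exact Measurable.ite (hr (measurableSet_singleton 0)) measurable_const
    (hexp.measurable.comp (Real.measurable_log.comp hr))

theorem hasACMarginals_jumpMeasure (j : ℝ → ℝ) :
    HasACMarginals (volume : Measure 𝔼 d) (jumpMeasure j) where
  fst := Measure.quasiMeasurePreserving_fst.mono_left (withDensity_absolutelyContinuous _ _)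
  snd := Measure.quasiMeasurePreserving_snd.mono_left (withDensity_absolutelyContinuous _ _)

instance (j : ℝ → ℝ) : SFinite (jumpMeasure j : Measure (𝔼 d × 𝔼 d)) :=
  inferInstanceAs (SFinite ((volume.prod volume).withDensity _))

namespace IsLevyProfile

theorem measurable_kernel (hj : IsLevyProfile d j) :
    Measurable fun p : 𝔼 d × 𝔼 d => kernel j p.1 p.2 :=
  measurable_comp_of_antitoneOn_Ioi hj.anti (by fun_prop) fun _ => norm_nonneg _

theorem measurable_kernelDensity (hj : IsLevyProfile d j) :
    Measurable (kernelDensity j : 𝔼 d × 𝔼 d → ℝ≥0∞) :=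
  hj.measurable_kernel.ennreal_ofReal

theorem measurable_levyDensity (hj : IsLevyProfile d j) :
    Measurable (levyDensity j : 𝔼 d × 𝔼 d → ℝ≥0∞) :=
  ((measurable_const.min ((measurable_fst.sub measurable_snd).norm.pow_const 2)).mul
    hj.measurable_kernel).ennreal_ofReal

theorem kernel_pos (hj : IsLevyProfile d j) {x y : 𝔼 d} (h : x ≠ y) : 0 < kernel j x y :=
  hj.pos _ (norm_pos_iff.2 (sub_ne_zero.2 h))

theorem lintegral_jumpMeasure (hj : IsLevyProfile d j) (f : 𝔼 d × 𝔼 d → ℝ≥0∞)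
    {s : Set (𝔼 d × 𝔼 d)} (hs : MeasurableSet s) :
    ∫⁻ p in s, f p ∂jumpMeasure j =
      ∫⁻ p in s, kernelDensity j p * f p ∂volume.prod volume := by
  rw [jumpMeasure, restrict_withDensity hs,
    lintegral_withDensity_eq_lintegral_mul_non_measurable _ hj.measurable_kernelDensity
      (ae_of_all _ fun _ => ENNReal.ofReal_lt_top)]
  rfl

theorem lintegralSq_jumpMeasure (hj : IsLevyProfile d j) (f : 𝔼 d × 𝔼 d → ℝ) :
    lintegralSq (jumpMeasure j) f =
      ∫⁻ p, kernelDensity j p * ENNReal.ofReal (f p ^ 2) ∂volume.prod volume := by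
  simpa only [Measure.restrict_univ, lintegralSq]
    using hj.lintegral_jumpMeasure (fun p => ENNReal.ofReal (f p ^ 2)) .univ

theorem lintegralSq_restrictedJumpMeasure (hj : IsLevyProfile d j) (hD : MeasurableSet D)
    (f : 𝔼 d × 𝔼 d → ℝ) :
    lintegralSq (restrictedJumpMeasure j D) f =
      ∫⁻ p in (Dᶜ ×ˢ Dᶜ)ᶜ, kernelDensity j p * ENNReal.ofReal (f p ^ 2) ∂volume.prod volume :=
  hj.lintegral_jumpMeasure _ (hD.compl.prod hD.compl).compl

theorem energy_eq (hj : IsLevyProfile d j) (hD : MeasurableSet D) (u : 𝔼 d → ℝ) :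
    energy j D u = 2⁻¹ * lintegralSq (restrictedJumpMeasure j D) (increment u) := by
  rw [energy, hj.lintegralSq_restrictedJumpMeasure hD]
  congr 1
  refine lintegral_congr fun p => ?_
  rw [ENNReal.ofReal_mul (sq_nonneg _), mul_comm, kernelDensity, increment_apply]

theorem formDomain_eq (hj : IsLevyProfile d j) (hD : MeasurableSet D) :
    formDomain j D = jumpDomain (refMeasure j D) (restrictedJumpMeasure j D) := by
  ext u
  simp only [formDomain, jumpDomain, Set.mem_ofPred_eq, hj.energy_eq hD,
    ENNReal.mul_lt_top_iff]
  simp +contextual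

theorem formLp_eq (hj : IsLevyProfile d j) (hD : MeasurableSet D) :
    formLp j D = jumpForm (refMeasure j D) (restrictedJumpMeasure j D) := by
  funext u v
  rw [formLp, form, jumpForm, restrictedJumpMeasure, jumpMeasure,
    restrict_withDensity (hD.compl.prod hD.compl).compl,
    integral_withDensity_eq_integral_toReal_smul hj.measurable_kernelDensity
      (ae_of_all _ fun _ => ENNReal.ofReal_lt_top)]
  congr 1
  refine integral_congr_ae (ae_of_all _ fun p => ?_)
  simp only [increment_apply]
  rcases eq_or_ne p.1 p.2 with h | h
  · simp [h]
  · rw [kernelDensity, ENNReal.toReal_ofReal (hj.kernel_pos h).le, smul_eq_mul]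
    ring

theorem lintegral_mul_levyDensity_fst (hj : IsLevyProfile d j) {w : 𝔼 d → ℝ≥0∞}
    (hw : Measurable w) :
    ∫⁻ p, w p.1 * levyDensity j p ∂(volume : Measure (𝔼 d)).prod volume =
      (∫⁻ x, w x) * ∫⁻ x : 𝔼 d, ENNReal.ofReal (min 1 (‖x‖ ^ 2) * j ‖x‖) := by
  have hl := hj.measurable_levyDensity
  rw [lintegral_prod _ (by fun_prop), ← lintegral_mul_const _ hw]
  refine lintegral_congr fun x => ?_
  dsimp only
  rw [lintegral_const_mul _ (by fun_prop)]
  congr 1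
  exact lintegral_sub_left_eq_self
    (fun z : 𝔼 d => ENNReal.ofReal (min 1 (‖z‖ ^ 2) * j ‖z‖)) x

theorem lintegral_mul_levyDensity_snd (hj : IsLevyProfile d j) {w : 𝔼 d → ℝ≥0∞}
    (hw : Measurable w) :
    ∫⁻ p, w p.2 * levyDensity j p ∂(volume : Measure (𝔼 d)).prod volume =
      (∫⁻ x, w x) * ∫⁻ x : 𝔼 d, ENNReal.ofReal (min 1 (‖x‖ ^ 2) * j ‖x‖) := by
  rw [← hj.lintegral_mul_levyDensity_fst hw, ← lintegral_prod_swap]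
  simp only [levyDensity_swap, Prod.snd_swap]

end IsLevyProfile

end Kernel

section BoundedLipschitz

variable {j : ℝ → ℝ} {χ u : 𝔼 d → ℝ} {K : NNReal} {M : ℝ}

theorem kernelDensity_mul_sq_increment_le (hχ : LipschitzWith K χ) (hM : ∀ x, |χ x| ≤ M)
    (p : 𝔼 d × 𝔼 d) :
    kernelDensity j p * ENNReal.ofReal (increment χ p ^ 2) ≤
      ENNReal.ofReal (4 * M ^ 2 + K ^ 2) * levyDensity j p := by
  have hlip : |increment χ p| ≤ K * ‖p.1 - p.2‖ := by
    simpa [Real.dist_eq, increment_apply, dist_eq_norm] using hχ.dist_le_mul p.1 p.2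
  have hbdd : |increment χ p| ≤ 2 * M := by
    rw [increment_apply]
    linarith [abs_sub (χ p.1) (χ p.2), hM p.1, hM p.2]
  have hsq : increment χ p ^ 2 ≤ (4 * M ^ 2 + K ^ 2) * min 1 (‖p.1 - p.2‖ ^ 2) := by
    rw [← sq_abs]
    rcases min_cases 1 (‖p.1 - p.2‖ ^ 2) with ⟨h, -⟩ | ⟨h, -⟩ <;> rw [h]
    · nlinarith [pow_le_pow_left₀ (abs_nonneg _) hbdd 2, sq_nonneg (K : ℝ)]
    · nlinarith [pow_le_pow_left₀ (abs_nonneg _) hlip 2,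
        mul_nonneg (sq_nonneg M) (sq_nonneg ‖p.1 - p.2‖)]
  have hC : 0 ≤ 4 * M ^ 2 + (K : ℝ) ^ 2 := by positivity
  rw [kernelDensity, levyDensity, ENNReal.ofReal_mul (by positivity), ← mul_assoc,
    ← ENNReal.ofReal_mul hC, mul_comm]
  exact mul_le_mul_left (ENNReal.ofReal_le_ofReal hsq) _

namespace IsLevyProfile

theorem lintegralSq_mul_increment_lt_top (hj : IsLevyProfile d j) (hχ : LipschitzWith K χ)
    (hM : ∀ x, |χ x| ≤ M) (hu : Measurable u) (hu2 : lintegralSq volume u < ∞) :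
    lintegralSq (jumpMeasure j) (fun p => u p.2 * increment χ p) < ∞ := by
  have hle (p : 𝔼 d × 𝔼 d) : kernelDensity j p * ENNReal.ofReal ((u p.2 * increment χ p) ^ 2) ≤
      ENNReal.ofReal (4 * M ^ 2 + K ^ 2) * (ENNReal.ofReal (u p.2 ^ 2) * levyDensity j p) := by
    rw [mul_pow, ENNReal.ofReal_mul (sq_nonneg _), mul_left_comm,
      mul_left_comm (ENNReal.ofReal (4 * M ^ 2 + K ^ 2))]
    gcongr _ * ?_
    exact kernelDensity_mul_sq_increment_le hχ hM p
  rw [hj.lintegralSq_jumpMeasure]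
  refine (lintegral_mono hle).trans_lt ?_
  rw [lintegral_const_mul' _ _ ENNReal.ofReal_ne_top,
    hj.lintegral_mul_levyDensity_snd (w := fun x => ENNReal.ofReal (u x ^ 2)) (by fun_prop)]
  exact ENNReal.mul_lt_top ENNReal.ofReal_lt_top (ENNReal.mul_lt_top hu2 hj.levy)

theorem hasFiniteEnergy_mul_of_lipschitz (hj : IsLevyProfile d j) (hχ : LipschitzWith K χ)
    (hM : ∀ x, |χ x| ≤ M) (hu : HasFiniteEnergy volume (jumpMeasure j) u) :
    HasFiniteEnergy volume (jumpMeasure j) (χ * u) := by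
  have hmul : ∀ {Y : Type _} [MeasurableSpace Y] {μ : Measure Y} {f g : Y → ℝ},
      (∀ x, |f x| ≤ M) → lintegralSq μ g < ∞ → lintegralSq μ (f * g) < ∞ := fun hf hg =>
    (lintegralSq_mul_le_of_abs_le hf).trans_lt (ENNReal.mul_lt_top ENNReal.ofReal_lt_top hg)
  obtain ⟨hE, h2⟩ := ENNReal.add_lt_top.1 hu.lt_top
  refine ⟨hχ.continuous.measurable.mul hu.measurable, ENNReal.add_lt_top.2 ⟨?_, hmul hM h2⟩⟩
  refine (lintegralSq_increment_mul_le hχ.continuous.measurable hu.measurable).trans_lt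
    (ENNReal.mul_lt_top (by simp) (ENNReal.add_lt_top.2
      ⟨hmul (f := fun p : 𝔼 d × 𝔼 d => χ p.1) (fun p => hM p.1) hE,
        hj.lintegralSq_mul_increment_lt_top hχ hM hu.measurable h2⟩))

theorem hasFiniteEnergy_of_lipschitz (hj : IsLevyProfile d j) (hχ : LipschitzWith K χ)
    (hM : ∀ x, |χ x| ≤ M) (hsupp : volume (Function.support χ) < ∞) :
    HasFiniteEnergy volume (jumpMeasure j) χ := by
  let w : 𝔼 d → ℝ≥0∞ := (Function.support χ).indicator 1
  have hS : MeasurableSet (Function.support χ) := measurableSet_support hχ.continuous.measurable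
  have hw : Measurable w := measurable_one.indicator hS
  have hwfin : ∫⁻ x, w x < ∞ := by rwa [lintegral_indicator_one hS]
  have hw1 (x : 𝔼 d) (hx : χ x ≠ 0) : w x = 1 := Set.indicator_of_mem hx 1
  refine ⟨hχ.continuous.measurable, ENNReal.add_lt_top.2 ⟨?_, ?_⟩⟩
  · have hle (p : 𝔼 d × 𝔼 d) : kernelDensity j p * ENNReal.ofReal (increment χ p ^ 2) ≤
        ENNReal.ofReal (4 * M ^ 2 + K ^ 2) *
          (w p.1 * levyDensity j p + w p.2 * levyDensity j p) := by
      by_cases h : χ p.1 = 0 ∧ χ p.2 = 0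
      · simp [increment_apply, h.1, h.2]
      refine (kernelDensity_mul_sq_increment_le hχ hM p).trans ?_
      gcongr
      rcases not_and_or.1 h with h | h <;> simp [hw1 _ h]
    have hl := hj.measurable_levyDensity
    rw [hj.lintegralSq_jumpMeasure]
    refine (lintegral_mono hle).trans_lt ?_
    rw [lintegral_const_mul' _ _ ENNReal.ofReal_ne_top, lintegral_add_left (by fun_prop),
      hj.lintegral_mul_levyDensity_fst hw, hj.lintegral_mul_levyDensity_snd hw]
    have := ENNReal.mul_lt_top hwfin hj.levy
    exact ENNReal.mul_lt_top ENNReal.ofReal_lt_top (ENNReal.add_lt_top.2 ⟨this, this⟩)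
  · have hle (x : 𝔼 d) : ENNReal.ofReal (χ x ^ 2) ≤ ENNReal.ofReal (M ^ 2) * w x := by
      by_cases h : χ x = 0
      · simp [h]
      rw [hw1 x h, mul_one, ← sq_abs]
      exact ENNReal.ofReal_le_ofReal (pow_le_pow_left₀ (abs_nonneg _) (hM x) 2)
    refine (lintegral_mono hle).trans_lt ?_
    rw [lintegral_const_mul' _ _ ENNReal.ofReal_ne_top]
    exact ENNReal.mul_lt_top ENNReal.ofReal_lt_top hwfin

end IsLevyProfile

end BoundedLipschitz

variable {j : ℝ → ℝ} {D : Set 𝔼 d}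

section RefMeasure

theorem refMeasure_absolutelyContinuous (j : ℝ → ℝ) (D : Set 𝔼 d) : refMeasure j D ≪ volume :=
  Measure.restrict_le_self.absolutelyContinuous.add_left
    ((withDensity_absolutelyContinuous _ _).trans Measure.restrict_le_self.absolutelyContinuous)

theorem restrict_le_refMeasure (j : ℝ → ℝ) (D : Set 𝔼 d) : volume.restrict D ≤ refMeasure j D :=
  Measure.le_add_right le_rfl

theorem restrict_refMeasure (j : ℝ → ℝ) (hD : MeasurableSet D) :
    (refMeasure j D).restrict D = volume.restrict D := by
  rw [refMeasure, Measure.restrict_add, restrict_withDensity hD, Measure.restrict_restrict hD,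
    Measure.restrict_restrict hD, Set.inter_self, Set.inter_compl_self, Measure.restrict_empty,
    withDensity_zero_left, add_zero]

namespace IsLevyProfile

theorem measurable_kernel_right (hj : IsLevyProfile d j) (x : 𝔼 d) :
    Measurable fun y => ENNReal.ofReal (kernel j x y) :=
  (hj.measurable_kernel.comp measurable_prodMk_left).ennreal_ofReal

theorem measurable_mu (hj : IsLevyProfile d j) (D : Set 𝔼 d) : Measurable (mu j D) :=
  hj.measurable_kernelDensity.lintegral_prod_right'

theorem mu_pos (hj : IsLevyProfile d j) (hD : IsOpen D) (hne : D.Nonempty) {x : 𝔼 d}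
    (hx : x ∉ D) : 0 < mu j D x := by
  have hsub : D ⊆ Function.support fun y => ENNReal.ofReal (kernel j x y) := fun y hy =>
    (ENNReal.ofReal_pos.2 (hj.kernel_pos (ne_of_mem_of_not_mem hy hx).symm)).ne'
  rw [mu, lintegral_pos_iff_support (hj.measurable_kernel_right x),
    Measure.restrict_apply' hD.measurableSet, Set.inter_eq_self_of_subset_right hsub]
  exact hD.measure_pos _ hne

theorem mu_le (hj : IsLevyProfile d j) (hD : MeasurableSet D) {x : 𝔼 d} {r : ℝ} (hr : 0 < r)
    (hx : r ≤ Metric.infDist x D) : mu j D x ≤ ENNReal.ofReal (j r) * volume D := by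
  rw [mu, ← setLIntegral_const]
  refine setLIntegral_mono' hD fun y hy => ENNReal.ofReal_le_ofReal ?_
  have hxy : r ≤ ‖x - y‖ := hx.trans (dist_eq_norm x y ▸ Metric.infDist_le_dist_of_mem hy)
  exact hj.anti hr (hr.trans_le hxy) hxy

theorem lintegral_refMeasure (hj : IsLevyProfile d j) (D : Set 𝔼 d) {f : 𝔼 d → ℝ≥0∞}
    (hf : Measurable f) :
    ∫⁻ x, f x ∂refMeasure j D = (∫⁻ x in D, f x) + ∫⁻ x in Dᶜ, mu j D x * f x := by
  rw [refMeasure, lintegral_add_measure,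
    lintegral_withDensity_eq_lintegral_mul _ (hj.measurable_mu D) hf]
  rfl

theorem absolutelyContinuous_refMeasure (hj : IsLevyProfile d j) (hD : IsOpen D)
    (hne : D.Nonempty) : volume ≪ refMeasure j D := by
  have hout : volume.restrict Dᶜ ≪ (volume.restrict Dᶜ).withDensity (mu j D) :=
    withDensity_absolutelyContinuous' (hj.measurable_mu D).aemeasurable
      ((ae_restrict_mem hD.measurableSet.compl).mono fun x hx => (hj.mu_pos hD hne hx).ne')
  rw [← Measure.restrict_add_restrict_compl (μ := volume) hD.measurableSet]
  exact Measure.AbsolutelyContinuous.rfl.add hout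

theorem hasACMarginals (hj : IsLevyProfile d j) (hD : IsOpen D) (hne : D.Nonempty) :
    HasACMarginals (refMeasure j D) (restrictedJumpMeasure j D) where
  fst := (hasACMarginals_jumpMeasure j).fst.mono Measure.restrict_le_self.absolutelyContinuous
    (hj.absolutelyContinuous_refMeasure hD hne)
  snd := (hasACMarginals_jumpMeasure j).snd.mono Measure.restrict_le_self.absolutelyContinuous
    (hj.absolutelyContinuous_refMeasure hD hne)

theorem sigmaFinite_refMeasure (hj : IsLevyProfile d j) (hD : IsOpen D) (hne : D.Nonempty)
    (hb : Bornology.IsBounded D) (hfr : volume (frontier D) = 0) :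
    SigmaFinite (refMeasure j D) := by
  have hmu : ∀ᵐ x ∂volume.restrict Dᶜ, mu j D x ≠ ∞ := by
    rw [ae_restrict_iff' hD.measurableSet.compl]
    filter_upwards [measure_eq_zero_iff_ae_notMem.1 hfr] with x hx hxD
    have hxc : x ∉ closure D := fun h => hx (hD.frontier_eq ▸ ⟨h, hxD⟩)
    exact ((hj.mu_le hD.measurableSet ((Metric.infDist_pos_iff_notMem_closure hne).1 hxc)
      le_rfl).trans_lt (ENNReal.mul_lt_top ENNReal.ofReal_lt_top hb.measure_lt_top)).ne
  have := SigmaFinite.withDensity_of_ne_top hmu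
  rw [refMeasure]
  infer_instance

end IsLevyProfile

end RefMeasure

section Splitting

theorem lintegralSq_increment_restrictedJumpMeasure {u : 𝔼 d → ℝ} (h0 : ∀ x ∉ D, u x = 0) :
    lintegralSq (restrictedJumpMeasure j D) (increment u) =
      lintegralSq (jumpMeasure j) (increment u) := by
  refine setLIntegral_eq_of_support_subset fun p hp hp' => hp ?_
  simp [increment_apply, h0 _ hp'.1, h0 _ hp'.2]

namespace IsLevyProfile

theorem lintegralSq_refMeasure_of_zero_off (hj : IsLevyProfile d j) (hD : MeasurableSet D)
    {u : 𝔼 d → ℝ} (hu : Measurable u) (h0 : ∀ x ∉ D, u x = 0) :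
    lintegralSq (refMeasure j D) u = lintegralSq volume u := by
  have hout : ∫⁻ x in Dᶜ, mu j D x * ENNReal.ofReal (u x ^ 2) = 0 :=
    setLIntegral_eq_zero hD.compl fun x hx => by simp [h0 x hx]
  rw [lintegralSq, hj.lintegral_refMeasure D (by fun_prop), hout, add_zero]
  exact setLIntegral_eq_of_support_subset fun x hx => by_contra fun h => hx (by simp [h0 x h])

theorem energyOne_of_zero_off (hj : IsLevyProfile d j) (hD : MeasurableSet D)
    {u : 𝔼 d → ℝ} (hu : Measurable u) (h0 : ∀ x ∉ D, u x = 0) :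
    energyOne (refMeasure j D) (restrictedJumpMeasure j D) u =
      energyOne volume (jumpMeasure j) u := by
  rw [energyOne, energyOne, lintegralSq_increment_restrictedJumpMeasure h0,
    hj.lintegralSq_refMeasure_of_zero_off hD hu h0]

theorem lintegral_kernelDensity_mul_fst (hj : IsLevyProfile d j) (D : Set 𝔼 d)
    {f : 𝔼 d → ℝ≥0∞} (hf : Measurable f) :
    ∫⁻ p, kernelDensity j p * f p.1 ∂volume.prod (volume.restrict D) = ∫⁻ x, mu j D x * f x := by
  have hk := hj.measurable_kernelDensity
  rw [lintegral_prod _ (by fun_prop)]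
  refine lintegral_congr fun x => ?_
  simp only [kernelDensity, lintegral_mul_const _ (hj.measurable_kernel_right x), mu]

theorem lintegralSq_increment_le_of_zero_on (hj : IsLevyProfile d j) (hD : MeasurableSet D)
    {h : 𝔼 d → ℝ} (hh : Measurable h) (h0 : ∀ x ∈ D, h x = 0) :
    lintegralSq (restrictedJumpMeasure j D) (increment h) ≤ 2 * lintegralSq (refMeasure j D) h := by
  set f : 𝔼 d → ℝ≥0∞ := fun x => ENNReal.ofReal (h x ^ 2)
  have hf : Measurable f := by fun_prop
  have hm : ∫⁻ x, mu j D x * f x ≤ lintegralSq (refMeasure j D) h := by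
    have hsupp : ∫⁻ x in Dᶜ, mu j D x * f x = ∫⁻ x, mu j D x * f x :=
      setLIntegral_eq_of_support_subset fun x hx hxD => hx (by simp [f, h0 x hxD])
    rw [lintegralSq, hj.lintegral_refMeasure D (by fun_prop), ← hsupp]
    exact le_add_self
  have hfst : ∫⁻ p in Set.univ ×ˢ D, kernelDensity j p * ENNReal.ofReal (increment h p ^ 2)
      ∂volume.prod volume = ∫⁻ x, mu j D x * f x := by
    rw [← hj.lintegral_kernelDensity_mul_fst D hf]
    nth_rw 3 [← Measure.restrict_univ (μ := volume)]
    rw [Measure.prod_restrict]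
    refine setLIntegral_congr_fun (MeasurableSet.univ.prod hD) fun p hp => ?_
    simp [f, increment_apply, h0 p.2 hp.2]
  have hsnd : ∫⁻ p in D ×ˢ Set.univ, kernelDensity j p * ENNReal.ofReal (increment h p ^ 2)
      ∂volume.prod volume = ∫⁻ x, mu j D x * f x := by
    rw [← hfst, ← Measure.prod_restrict, ← Measure.prod_restrict, ← lintegral_prod_swap]
    refine lintegral_congr fun p => ?_
    rw [kernelDensity_swap, increment_apply, increment_apply, Prod.fst_swap, Prod.snd_swap,
      sub_sq_comm]
  have hcover : (Dᶜ ×ˢ Dᶜ)ᶜ ⊆ (Set.univ ×ˢ D) ∪ (D ×ˢ Set.univ) := fun p hp => by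
    by_contra! hp'
    simp_all
  calc lintegralSq (restrictedJumpMeasure j D) (increment h)
      = ∫⁻ p in (Dᶜ ×ˢ Dᶜ)ᶜ, kernelDensity j p * ENNReal.ofReal (increment h p ^ 2)
          ∂volume.prod volume := hj.lintegralSq_restrictedJumpMeasure hD _
    _ ≤ (∫⁻ x, mu j D x * f x) + ∫⁻ x, mu j D x * f x := by
        refine (lintegral_mono_set hcover).trans ((lintegral_union_le _ _ _).trans ?_)
        rw [hfst, hsnd]
    _ ≤ 2 * lintegralSq (refMeasure j D) h := two_mul (lintegralSq (refMeasure j D) h) ▸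
        add_le_add hm hm

theorem energyOne_le_of_zero_on (hj : IsLevyProfile d j) (hD : MeasurableSet D)
    {h : 𝔼 d → ℝ} (hh : Measurable h) (h0 : ∀ x ∈ D, h x = 0) :
    energyOne (refMeasure j D) (restrictedJumpMeasure j D) h ≤
      3 * lintegralSq (refMeasure j D) h := by
  refine (add_le_add_left (hj.lintegralSq_increment_le_of_zero_on hD hh h0) _).trans_eq ?_
  ring

end IsLevyProfile

end Splitting

section Density

namespace IsLevyProfile

theorem hasFiniteEnergy_indicator_compl (hj : IsLevyProfile d j) (hD : MeasurableSet D)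
    {u : 𝔼 d → ℝ} (hu : Measurable u) (hu2 : MemLp u 2 (refMeasure j D)) :
    HasFiniteEnergy (refMeasure j D) (restrictedJumpMeasure j D) (Dᶜ.indicator u) where
  measurable := hu.indicator hD.compl
  lt_top := by
    have hL := hu2.indicator hD.compl
    refine (hj.energyOne_le_of_zero_on hD (hu.indicator hD.compl) fun x hx => ?_).trans_lt
      (ENNReal.mul_lt_top (by simp) ((memLp_two_iff_lintegralSq_lt_top hL.1).1 hL))
    exact Set.indicator_of_notMem (Set.notMem_compl_iff.2 hx) u

theorem hasFiniteEnergy_of_contDiff (hj : IsLevyProfile d j) (hD : MeasurableSet D)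
    {φ : 𝔼 d → ℝ} (hφ : ContDiff ℝ 1 φ) (hc : HasCompactSupport φ) (hs : tsupport φ ⊆ D) :
    HasFiniteEnergy (refMeasure j D) (restrictedJumpMeasure j D) φ := by
  obtain ⟨M, hM⟩ := hc.exists_bound_of_continuous hφ.continuous
  obtain ⟨K, hK⟩ := hφ.lipschitzWith_of_hasCompactSupport hc one_ne_zero
  have hfree := hj.hasFiniteEnergy_of_lipschitz hK hM
    ((measure_mono (subset_tsupport φ)).trans_lt (hc.isCompact.measure_lt_top))
  refine ⟨hfree.measurable, ?_⟩
  rw [hj.energyOne_of_zero_off hD hfree.measurable fun x hx =>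
    image_eq_zero_of_notMem_tsupport fun h => hx (hs h)]
  exact hfree.lt_top

end IsLevyProfile

theorem integral_mul_eq_zero_of_mem_orthogonal {X : Type*} [MeasurableSpace X] {m : Measure X}
    {ν : Measure (X × X)} (h : HasACMarginals m ν) {w : Lp ℝ 2 m}
    (hw : w ∈ h.domainSubmoduleᗮ) {g : X → ℝ} (hg : HasFiniteEnergy m ν g) :
    ∫ x, g x * w x ∂m = 0 := by
  rw [← (Submodule.mem_orthogonal _ _).1 hw _ (h.toLp_mem_jumpDomain hg.memLp hg.lt_top),
    L2.inner_def]
  refine integral_congr_ae ?_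
  filter_upwards [hg.memLp.coeFn_toLp] with x hx
  simp [hx, mul_comm]

namespace IsLevyProfile

theorem dense_jumpDomain (hj : IsLevyProfile d j) (hD : IsOpen D) (hne : D.Nonempty)
    (hb : Bornology.IsBounded D) :
    Dense (jumpDomain (refMeasure j D) (restrictedJumpMeasure j D)) := by
  set m := refMeasure j D
  have hac := hj.hasACMarginals hD hne
  have hDm := hD.measurableSet
  change Dense (hac.domainSubmodule : Set (Lp ℝ 2 m))
  rw [Submodule.dense_iff_topologicalClosure_eq_top, Submodule.topologicalClosure_eq_top_iff,
    Submodule.eq_bot_iff]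
  intro w hw
  have hwm : Measurable w := (Lp.stronglyMeasurable w).measurable
  have hout : ∀ᵐ x ∂m, x ∉ D → w x = 0 := by
    have hw2 : Integrable (fun x => Dᶜ.indicator w x * w x) m :=
      ((Lp.memLp w).indicator hDm.compl).integrable_mul (Lp.memLp w)
    have hsq : 0 ≤ fun x => Dᶜ.indicator w x * w x := fun x => by
      by_cases hx : x ∈ D <;> simp [hx, mul_self_nonneg]
    have hint := integral_mul_eq_zero_of_mem_orthogonal hac hw
      (hj.hasFiniteEnergy_indicator_compl hDm hwm (Lp.memLp w))
    filter_upwards [(integral_eq_zero_iff_of_nonneg hsq hw2).1 hint] with x hx hxD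
    simpa [hxD] using hx
  have hin : ∀ᵐ x, x ∈ D → w x = 0 := by
    have : IsFiniteMeasure (volume.restrict D) := ⟨by simpa using hb.measure_lt_top⟩
    have hwi : IntegrableOn w D volume :=
      ((Lp.memLp w).mono_measure (restrict_le_refMeasure j D)).integrable (by norm_num)
    refine hD.ae_eq_zero_of_integral_contDiff_smul_eq_zero hwi.locallyIntegrableOn
      fun φ hφ hφc hφs => ?_
    have hφ := hj.hasFiniteEnergy_of_contDiff hDm (hφ.of_le (mod_cast le_top)) hφc hφs
    have h0 : ∀ x ∉ D, φ x * w x = 0 := fun x hx => by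
      rw [image_eq_zero_of_notMem_tsupport fun h => hx (hφs h), zero_mul]
    simp only [smul_eq_mul]
    rw [← setIntegral_eq_integral_of_forall_compl_eq_zero h0, ← restrict_refMeasure j hDm,
      setIntegral_eq_integral_of_forall_compl_eq_zero h0]
    exact integral_mul_eq_zero_of_mem_orthogonal hac hw hφ
  rw [Lp.eq_zero_iff_ae_eq_zero]
  filter_upwards [hout, (refMeasure_absolutelyContinuous j D).ae_le hin] with x hx1 hx2
  exact (em (x ∈ D)).elim hx2 hx1

end IsLevyProfile

end Density

section Mollification

namespace IsLevyProfile

-- `jumpMeasure j` need not be locally finite near the diagonal, while `volume.prod volume` is.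
theorem lintegralSq_jumpMeasure_eq_mul_sqrt (hj : IsLevyProfile d j) (f : 𝔼 d × 𝔼 d → ℝ) :
    lintegralSq (jumpMeasure j) f =
      lintegralSq (volume.prod volume) fun p => f p * √(kernelDensity j p).toReal := by
  rw [hj.lintegralSq_jumpMeasure, lintegralSq]
  refine lintegral_congr fun p => ?_
  rw [mul_pow, Real.sq_sqrt ENNReal.toReal_nonneg, ENNReal.ofReal_mul (sq_nonneg _),
    ENNReal.ofReal_toReal (by simp [kernelDensity]), mul_comm]

theorem tendsto_energyOne_translate (hj : IsLevyProfile d j) {u : 𝔼 d → ℝ}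
    (hu : HasFiniteEnergy volume (jumpMeasure j) u) :
    Tendsto (fun t => energyOne volume (jumpMeasure j) fun x => u (t + x) - u x)
      (𝓝 0) (𝓝 0) := by
  let f : 𝔼 d × 𝔼 d → ℝ := fun p => increment u p * √(kernelDensity j p).toReal
  have hf : MemLp f 2 (volume.prod volume) := by
    have := hj.measurable_kernelDensity
    have := hu.measurable
    have hfm : Measurable f := by
      simp only [f, increment_apply]
      fun_prop
    rw [memLp_two_iff_lintegralSq_lt_top hfm.aestronglyMeasurable,
      ← hj.lintegralSq_jumpMeasure_eq_mul_sqrt]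
    exact le_self_add.trans_lt hu.lt_top
  have hdiag : Tendsto (fun t : 𝔼 d => (t, t)) (𝓝 0) (𝓝 (0 : 𝔼 d × 𝔼 d)) :=
    Continuous.tendsto (by fun_prop) 0
  have hlim := ((tendsto_lintegralSq_translate hf).comp hdiag).add
    (tendsto_lintegralSq_translate hu.memLp)
  rw [add_zero] at hlim
  refine hlim.congr fun t => ?_
  rw [energyOne, hj.lintegralSq_jumpMeasure_eq_mul_sqrt, Function.comp_apply]
  congr 2
  funext p
  have hinv : kernelDensity j ((t, t) + p) = kernelDensity j p := by simp [kernelDensity, kernel]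
  simp only [f, hinv, increment_apply, Prod.fst_add, Prod.snd_add]
  ring

theorem exists_continuous_energyOne_sub_le (hj : IsLevyProfile d j) {u : 𝔼 d → ℝ}
    (hu : HasFiniteEnergy volume (jumpMeasure j) u) {ε : ℝ≥0∞} (hε : 0 < ε) :
    ∃ ψ : 𝔼 d → ℝ, Continuous ψ ∧ energyOne volume (jumpMeasure j) (u - ψ) ≤ ε := by
  obtain ⟨δ, hδ, hball⟩ := Metric.eventually_nhds_iff.1
    ((hj.tendsto_energyOne_translate hu).eventually_lt_const hε)
  let φ : ContDiffBump (0 : 𝔼 d) := ⟨δ / 2, δ, half_pos hδ, half_lt_self hδ⟩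
  have hloc : LocallyIntegrable u volume := hu.memLp.locallyIntegrable (by norm_num)
  have hi (x : 𝔼 d) : Integrable (fun t => u (x - t)) (bumpLaw volume φ) :=
    integrable_bumpLaw φ hloc x
  refine ⟨_, continuous_integral_bumpLaw φ hloc, ?_⟩
  calc energyOne volume (jumpMeasure j) (u - fun x => ∫ t, u (x - t) ∂bumpLaw volume φ)
      = energyOne volume (jumpMeasure j) fun x => ∫ t, (u (x - t) - u x) ∂bumpLaw volume φ := by
        rw [energyOne_sub_comm]
        congr 1
        funext x
        rw [integral_sub (hi x) (integrable_const _), integral_const, probReal_univ, one_smul]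
        rfl
    _ ≤ ∫⁻ t, energyOne volume (jumpMeasure j) (fun x => u (x - t) - u x) ∂bumpLaw volume φ := by
        have := hu.measurable
        exact energyOne_integral_le (by unfold Function.uncurry; fun_prop)
          fun x => (hi x).sub (integrable_const _)
    _ ≤ ∫⁻ _, ε ∂bumpLaw volume φ := by
        refine lintegral_mono_ae ?_
        filter_upwards [ae_bumpLaw_norm_lt φ] with t ht
        simpa only [neg_add_eq_sub] using (hball (y := -t) (by simpa using ht)).le
    _ = ε := by simp

end IsLevyProfile

end Mollification

section ExteriorSet

/-- The `k`-th set of the exhaustion of the exterior of `D` by compact sets. -/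
def exteriorSet (D : Set 𝔼 d) (k : ℕ) : Set 𝔼 d :=
  {x | 1 / ((k : ℝ) + 1) ≤ Metric.infDist x D ∧ ‖x‖ ≤ k}

theorem isClosed_exteriorSet (D : Set 𝔼 d) (k : ℕ) : IsClosed (exteriorSet D k) :=
  (isClosed_le continuous_const (Metric.continuous_infDist_pt D)).inter
    (isClosed_le continuous_norm continuous_const)

theorem isCompact_exteriorSet (D : Set 𝔼 d) (k : ℕ) : IsCompact (exteriorSet D k) :=
  (isCompact_closedBall (0 : 𝔼 d) k).of_isClosed_subset (isClosed_exteriorSet D k)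
    fun _ hx => mem_closedBall_zero_iff.2 hx.2

theorem monotone_exteriorSet (D : Set 𝔼 d) : Monotone (exteriorSet D) := by
  intro k l hkl x hx
  have hkl' : (k : ℝ) ≤ l := Nat.cast_le.2 hkl
  exact ⟨le_trans (by gcongr) hx.1, hx.2.trans hkl'⟩

theorem notMem_exteriorSet_of_mem_closure {x : 𝔼 d} (hx : x ∈ closure D) (k : ℕ) :
    x ∉ exteriorSet D k := by
  rintro ⟨h, -⟩
  rw [← Metric.infDist_closure, Metric.infDist_zero_of_mem hx] at h
  exact h.not_gt (by positivity)

theorem disjoint_exteriorSet (D : Set 𝔼 d) (k : ℕ) : Disjoint (exteriorSet D k) D :=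
  Set.disjoint_right.2 fun _ hx => notMem_exteriorSet_of_mem_closure (subset_closure hx) k

theorem eventually_mem_exteriorSet (hne : D.Nonempty) {x : 𝔼 d} (hx : x ∉ closure D) :
    ∀ᶠ k in atTop, x ∈ exteriorSet D k := by
  have hpos := (Metric.infDist_pos_iff_notMem_closure hne).1 hx
  have hdist := (tendsto_one_div_add_atTop_nhds_zero_nat (𝕜 := ℝ)).eventually_lt_const hpos
  filter_upwards [hdist, eventually_ge_atTop ⌈‖x‖⌉₊] with k hk hkx
  exact ⟨hk.le, Nat.ceil_le.1 hkx⟩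

theorem exteriorSet_subset_interior (D : Set 𝔼 d) (k : ℕ) :
    exteriorSet D k ⊆ interior (exteriorSet D (k + 1)) := by
  have hopen : IsOpen {x | 1 / (((k + 1 : ℕ) : ℝ) + 1) < Metric.infDist x D ∧
      ‖x‖ < ((k + 1 : ℕ) : ℝ)} :=
    (isOpen_lt continuous_const (Metric.continuous_infDist_pt D)).inter
      (isOpen_lt continuous_norm continuous_const)
  have hk : (k : ℝ) < (k + 1 : ℕ) := Nat.cast_lt.2 k.lt_succ_self
  refine fun x hx => interior_maximal (fun _ hy => And.imp le_of_lt le_of_lt hy) hopen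
    ⟨lt_of_lt_of_le ?_ hx.1, hx.2.trans_lt hk⟩
  gcongr

theorem exists_exteriorSet_cutoff (D : Set 𝔼 d) (k : ℕ) : ∃ χ : 𝔼 d → ℝ, Continuous χ ∧
    (∀ x ∈ exteriorSet D k, χ x = 1) ∧ (∀ x ∉ exteriorSet D (k + 1), χ x = 0) ∧
    ∀ x, |χ x| ≤ 1 := by
  obtain ⟨χ, h1, h0, -, hI⟩ := exists_continuous_one_zero_of_isCompact
    (isCompact_exteriorSet D k) (t := (interior (exteriorSet D (k + 1)))ᶜ)
    isOpen_interior.isClosed_compl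
    (Set.disjoint_compl_right_iff_subset.2 (exteriorSet_subset_interior D k))
  exact ⟨χ, χ.continuous, h1, fun x hx => h0 fun h => hx (interior_subset h),
    fun x => abs_le.2 ⟨neg_one_lt_zero.le.trans (hI x).1, (hI x).2⟩⟩

theorem ae_notMem_frontier (hfr : volume (frontier D) = 0) :
    ∀ᵐ x ∂refMeasure j D, x ∉ frontier D :=
  (refMeasure_absolutelyContinuous j D).ae_le (measure_eq_zero_iff_ae_notMem.1 hfr)

theorem IsLevyProfile.refMeasure_exteriorSet_lt_top (hj : IsLevyProfile d j)
    (hD : MeasurableSet D) (hb : Bornology.IsBounded D) (k : ℕ) :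
    refMeasure j D (exteriorSet D k) < ∞ := by
  have hE := (isClosed_exteriorSet D k).measurableSet
  have hk : (0 : ℝ) < 1 / ((k : ℝ) + 1) := by positivity
  have hvol : volume.restrict Dᶜ (exteriorSet D k) < ∞ :=
    (Measure.restrict_apply_le _ _).trans_lt (isCompact_exteriorSet D k).measure_lt_top
  rw [refMeasure, Measure.add_apply, Measure.restrict_apply hE,
    (disjoint_exteriorSet D k).inter_eq, measure_empty, zero_add, withDensity_apply _ hE]
  calc ∫⁻ x in exteriorSet D k, mu j D x ∂volume.restrict Dᶜ
      ≤ ∫⁻ _ in exteriorSet D k, ENNReal.ofReal (j (1 / ((k : ℝ) + 1))) * volume D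
          ∂volume.restrict Dᶜ := setLIntegral_mono' hE fun x hx => hj.mu_le hD hk hx.1
    _ < ∞ := by
      rw [setLIntegral_const]
      exact ENNReal.mul_lt_top (ENNReal.mul_lt_top ENNReal.ofReal_lt_top hb.measure_lt_top) hvol

end ExteriorSet

section GluedNest

/-- The union of the part of `B k` in the closure of `D` and the `k`-th exterior set. -/
def gluedNest (D : Set 𝔼 d) (B : ℕ → Set 𝔼 d) (k : ℕ) : Set 𝔼 d :=
  (B k ∩ closure D) ∪ exteriorSet D k

theorem isClosed_gluedNest {B : ℕ → Set 𝔼 d} (hB : ∀ k, IsClosed (B k)) (k : ℕ) :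
    IsClosed (gluedNest D B k) :=
  ((hB k).inter isClosed_closure).union (isClosed_exteriorSet D k)

theorem isCompact_gluedNest (hb : Bornology.IsBounded D) {B : ℕ → Set 𝔼 d}
    (hB : ∀ k, IsClosed (B k)) (k : ℕ) : IsCompact (gluedNest D B k) :=
  ((Metric.isCompact_of_isClosed_isBounded isClosed_closure hb.closure).inter_left (hB k)).union
    (isCompact_exteriorSet D k)

theorem monotone_gluedNest (D : Set 𝔼 d) {B : ℕ → Set 𝔼 d} (hB : Monotone B) :
    Monotone (gluedNest D B) := fun _ _ h =>
  Set.union_subset_union (Set.inter_subset_inter_left _ (hB h)) (monotone_exteriorSet D h)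

theorem continuousOn_indicator_gluedNest {B : ℕ → Set 𝔼 d} (hB : ∀ k, IsClosed (B k)) {k : ℕ}
    {f : 𝔼 d → ℝ} (hf : ContinuousOn f (B k)) :
    ContinuousOn ((closure D).indicator f) (gluedNest D B k) := by
  refine ContinuousOn.union_of_isClosed ?_ ?_ ((hB k).inter isClosed_closure)
    (isClosed_exteriorSet D k)
  · exact (hf.mono Set.inter_subset_left).congr fun x hx => Set.indicator_of_mem hx.2 f
  · exact continuousOn_const.congr fun x hx => Set.indicator_of_notMem
      (fun hxD => notMem_exteriorSet_of_mem_closure hxD k hx) f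

namespace IsLevyProfile

theorem hasFiniteEnergy_indicator (hj : IsLevyProfile d j) (hD : IsOpen D) (hne : D.Nonempty)
    {u : 𝔼 d → ℝ} (hu : HasFiniteEnergy (refMeasure j D) (restrictedJumpMeasure j D) u) :
    HasFiniteEnergy volume (jumpMeasure j) (D.indicator u) := by
  have hDu := hu.measurable.indicator hD.measurableSet
  have hsub : u - D.indicator u = Dᶜ.indicator u :=
    sub_eq_of_eq_add (Set.indicator_compl_add_self D u).symm
  have hfin := (hj.hasACMarginals hD hne).hasFiniteEnergy_of_sub_lt_top hu hDu
    (hsub ▸ (hj.hasFiniteEnergy_indicator_compl hD.measurableSet hu.measurable hu.memLp).lt_top)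
  refine ⟨hDu, ?_⟩
  rw [← hj.energyOne_of_zero_off hD.measurableSet hDu
    fun x hx => Set.indicator_of_notMem hx u]
  exact hfin.lt_top

theorem tendsto_energyOne_indicator_diff_exteriorSet (hj : IsLevyProfile d j) (hD : IsOpen D)
    (hne : D.Nonempty) (hfr : volume (frontier D) = 0) {u : 𝔼 d → ℝ} (hu : Measurable u)
    (hu2 : MemLp u 2 (refMeasure j D)) :
    Tendsto (fun k => energyOne (refMeasure j D) (restrictedJumpMeasure j D)
      ((Dᶜ \ exteriorSet D k).indicator u)) atTop (𝓝 0) := by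
  have hm k : Measurable ((Dᶜ \ exteriorSet D k).indicator u) :=
    hu.indicator (hD.measurableSet.compl.diff (isClosed_exteriorSet D k).measurableSet)
  have hlim : Tendsto (fun k => lintegralSq (refMeasure j D)
      ((Dᶜ \ exteriorSet D k).indicator u)) atTop (𝓝 0) := by
    refine tendsto_lintegralSq_zero_of_dominated (g := u)
      (fun k => (hm k).aestronglyMeasurable)
      ((memLp_two_iff_lintegralSq_lt_top hu2.aestronglyMeasurable).1 hu2)
      (fun k => ae_of_all _ fun x => norm_indicator_le_norm_self u x) ?_
    filter_upwards [ae_notMem_frontier hfr] with x hx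
    refine tendsto_const_nhds.congr' ?_
    by_cases hxD : x ∈ D
    · exact Eventually.of_forall fun k =>
        (Set.indicator_of_notMem (fun h => h.1 hxD) u).symm
    · have hxc : x ∉ closure D := fun h => hx (hD.frontier_eq ▸ ⟨h, hxD⟩)
      filter_upwards [eventually_mem_exteriorSet hne hxc] with k hk
      exact (Set.indicator_of_notMem (fun h => h.2 hk) u).symm
  have hlim3 := ENNReal.Tendsto.const_mul (a := 3) hlim (Or.inr ENNReal.ofNat_ne_top)
  rw [mul_zero] at hlim3
  exact tendsto_of_tendsto_of_tendsto_of_le_of_le tendsto_const_nhds hlim3 (fun _ => zero_le)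
    fun k => hj.energyOne_le_of_zero_on hD.measurableSet (hm k) fun x hx =>
      Set.indicator_of_notMem (fun h => h.1 hx) u

theorem isNest_gluedNest (hj : IsLevyProfile d j) (hD : IsOpen D) (hne : D.Nonempty)
    (hfr : volume (frontier D) = 0) {B : ℕ → Set 𝔼 d}
    (hB : IsNestOn volume (jumpMeasure j) D B) :
    IsNest (jumpDomain (refMeasure j D) (restrictedJumpMeasure j D))
      (jumpForm (refMeasure j D) (restrictedJumpMeasure j D)) (gluedNest D B) := by
  have hc := hj.hasACMarginals hD hne
  have hDm := hD.measurableSet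
  refine hc.isNest (isClosed_gluedNest hB.isClosed) (monotone_gluedNest D hB.mono)
    fun u hu ε hε => ?_
  obtain ⟨η, hη, hlt⟩ := exists_two_mul_add_lt hε
  obtain ⟨k, g, hgm, hg0, hgB, hg⟩ := hB.approx (D.indicator u)
    (hj.hasFiniteEnergy_indicator hD hne hu) (fun x hx => Set.indicator_of_notMem hx u) η hη
  obtain ⟨l, hl, hkl⟩ := (((hj.tendsto_energyOne_indicator_diff_exteriorSet hD hne hfr
    hu.measurable hu.memLp).eventually_lt_const hη).and (eventually_ge_atTop k)).exists
  have hdm : Measurable (D.indicator u - g) := (hu.measurable.indicator hDm).sub hgm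
  refine ⟨l, g + (exteriorSet D l).indicator u,
    hgm.add (hu.measurable.indicator (isClosed_exteriorSet D l).measurableSet), ?_, ?_⟩
  · filter_upwards [(refMeasure_absolutelyContinuous j D).ae_le hgB] with x hx hxA
    have hgx : g x = 0 := by
      by_cases hxD : x ∈ D
      · exact hx fun h => hxA (Or.inl ⟨hB.mono hkl h, subset_closure hxD⟩)
      · exact hg0 x hxD
    rw [Pi.add_apply, hgx, Set.indicator_of_notMem fun h => hxA (Or.inr h), add_zero]
  · have hsplit : u - (g + (exteriorSet D l).indicator u) =
        (D.indicator u - g) + (Dᶜ \ exteriorSet D l).indicator u := by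
      rw [Set.indicator_sdiff (disjoint_exteriorSet D l).subset_compl_right]
      nth_rw 1 [← Set.indicator_self_add_compl D u]
      abel
    rw [← hj.energyOne_of_zero_off hDm hdm
      fun x hx => by rw [Pi.sub_apply, Set.indicator_of_notMem hx, hg0 x hx, sub_zero]] at hg
    rw [hsplit]
    exact (hc.energyOne_add_le hdm.aestronglyMeasurable).trans_lt (hlt _ _ hg hl)

end IsLevyProfile

end GluedNest

section ExteriorApproximation

namespace IsLevyProfile

theorem exists_continuous_lintegralSq_exteriorSet_le (hj : IsLevyProfile d j)
    (hD : MeasurableSet D) (hb : Bornology.IsBounded D) {u : 𝔼 d → ℝ}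
    (hu : MemLp u 2 (refMeasure j D)) (k : ℕ) {ε : ℝ≥0∞} (hε : ε ≠ 0) :
    ∃ h : 𝔼 d → ℝ, Continuous h ∧ (∀ x ∉ exteriorSet D (k + 1), h x = 0) ∧
      lintegralSq (refMeasure j D) ((exteriorSet D k).indicator u - h) ≤ ε := by
  set L := exteriorSet D (k + 1)
  set v := (exteriorSet D k).indicator u
  have : IsFiniteMeasure ((refMeasure j D).restrict L) :=
    ⟨by simpa using hj.refMeasure_exteriorSet_lt_top hD hb (k + 1)⟩
  have hv : MemLp v 2 ((refMeasure j D).restrict L) :=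
    (hu.indicator (isClosed_exteriorSet D k).measurableSet).restrict L
  obtain ⟨f, hf, -⟩ := hv.exists_boundedContinuous_eLpNorm_sub_le ENNReal.ofNat_ne_top
    (ε := min 1 ε) (by simp [hε])
  obtain ⟨χ, hχ, hχ1, hχ0, hχb⟩ := exists_exteriorSet_cutoff D k
  refine ⟨χ * f, hχ.mul f.continuous, fun x hx => mul_eq_zero_of_left (hχ0 x hx) _, ?_⟩
  have hsupp : Function.support (fun x => ENNReal.ofReal ((v - χ * f) x ^ 2)) ⊆ L := by
    refine Function.support_subset_iff'.2 fun x hx => ?_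
    have hxk : x ∉ exteriorSet D k := fun h => hx (monotone_exteriorSet D k.le_succ h)
    simp [v, hχ0 x hx, Set.indicator_of_notMem hxk]
  have hpt x : |(v - χ * f) x| ≤ |(v - f) x| := by
    by_cases hx : x ∈ exteriorSet D k
    · simp [hχ1 x hx]
    · simpa [v, Set.indicator_of_notMem hx, abs_mul] using
        mul_le_of_le_one_left (abs_nonneg (f x)) (hχb x)
  calc lintegralSq (refMeasure j D) (v - χ * f)
      = lintegralSq ((refMeasure j D).restrict L) (v - χ * f) :=
        (setLIntegral_eq_of_support_subset hsupp).symm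
    _ ≤ lintegralSq ((refMeasure j D).restrict L) (v - ⇑f) :=
        lintegralSq_mono_abs (ae_of_all _ hpt)
    _ ≤ min 1 ε ^ 2 := by
        rw [lintegralSq_eq_eLpNorm_sq]
        gcongr
    _ ≤ min 1 ε := pow_le_of_le_one zero_le (min_le_left _ _) two_ne_zero
    _ ≤ ε := min_le_right _ _

theorem exists_continuous_energyOne_indicator_compl_sub_lt (hj : IsLevyProfile d j)
    (hD : IsOpen D) (hne : D.Nonempty) (hb : Bornology.IsBounded D)
    (hfr : volume (frontier D) = 0) {u : 𝔼 d → ℝ} (hu : Measurable u)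
    (hu2 : MemLp u 2 (refMeasure j D)) {ε : ℝ≥0∞} (hε : 0 < ε) :
    ∃ h : 𝔼 d → ℝ, Continuous h ∧
      energyOne (refMeasure j D) (restrictedJumpMeasure j D) (Dᶜ.indicator u - h) < ε := by
  have hDm := hD.measurableSet
  obtain ⟨η, hη, hlt⟩ := exists_two_mul_add_lt hε
  obtain ⟨δ, hδ0, hδ⟩ := ENNReal.exists_nnreal_pos_mul_lt (a := 3) ENNReal.ofNat_ne_top hη.ne'
  obtain ⟨k, hk⟩ := ((hj.tendsto_energyOne_indicator_diff_exteriorSet hD hne hfr hu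
    hu2).eventually_lt_const hη).exists
  obtain ⟨h, hhc, hh0, hh⟩ := hj.exists_continuous_lintegralSq_exteriorSet_le hDm hb hu2 k
    (ENNReal.coe_ne_zero.2 hδ0.ne')
  have hE := (isClosed_exteriorSet D k).measurableSet
  have hnear : energyOne (refMeasure j D) (restrictedJumpMeasure j D)
      ((exteriorSet D k).indicator u - h) < η := by
    refine (hj.energyOne_le_of_zero_on hDm ((hu.indicator hE).sub hhc.measurable)
      fun x hx => ?_).trans_lt (lt_of_le_of_lt (by gcongr) (mul_comm (δ : ℝ≥0∞) 3 ▸ hδ))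
    have hxE := notMem_exteriorSet_of_mem_closure (subset_closure hx)
    rw [Pi.sub_apply, hh0 x (hxE _), sub_zero, Set.indicator_of_notMem (hxE k)]
  have hsplit : Dᶜ.indicator u - h =
      (Dᶜ \ exteriorSet D k).indicator u + ((exteriorSet D k).indicator u - h) := by
    rw [Set.indicator_sdiff (disjoint_exteriorSet D k).subset_compl_right]
    abel
  refine ⟨h, hhc, ?_⟩
  rw [hsplit]
  exact ((hj.hasACMarginals hD hne).energyOne_add_le
    (hu.indicator (hDm.compl.diff hE)).aestronglyMeasurable).trans_lt (hlt _ _ hk hnear)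

end IsLevyProfile

end ExteriorApproximation

section TruncatedCoordinates

/-- The coordinate functions truncated at height `R`, indexed by `some l`, together with the
constant `1`, indexed by `none`. -/
def truncCoord (R : ℝ) : Option (Fin d) → 𝔼 d → ℝ
  | none, _ => 1
  | some l, x => clamp R (x l)

theorem lipschitzWith_truncCoord (R : ℝ) (o : Option (Fin d)) :
    LipschitzWith 1 (truncCoord R o : 𝔼 d → ℝ) := by
  cases o with
  | none => exact (LipschitzWith.const 1).weaken zero_le_one
  | some l =>
    have hproj : LipschitzWith 1 fun x : 𝔼 d => x l :=
      LipschitzWith.of_dist_le_mul fun x y => by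
        simpa [dist_eq_norm] using PiLp.norm_apply_le (x - y) l
    exact ((lipschitzWith_clamp R).comp hproj).weaken (mul_one 1).le

theorem abs_truncCoord_le {R : ℝ} (hR : 0 ≤ R) (o : Option (Fin d)) (x : 𝔼 d) :
    |truncCoord R o x| ≤ max 1 R := by
  cases o with
  | none => exact abs_one.trans_le (le_max_left _ _)
  | some l => exact (abs_clamp_le hR _).trans (le_max_right _ _)

theorem truncCoord_some {R : ℝ} {x : 𝔼 d} (hx : ‖x‖ ≤ R) (l : Fin d) :
    truncCoord R (some l) x = x l :=
  clamp_of_abs_le ((PiLp.norm_apply_le x l).trans hx)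

theorem eq_of_forall_truncCoord_mul_eq {R a b : ℝ} {x y : 𝔼 d} (hx : ‖x‖ ≤ R) (hy : ‖y‖ ≤ R)
    (ha : a ≠ 0) (h : ∀ o, truncCoord R o x * a = truncCoord R o y * b) : x = y := by
  have hab : a = b := by simpa [truncCoord] using h none
  ext l
  have hl := h (some l)
  rw [truncCoord_some hx, truncCoord_some hy, ← hab] at hl
  exact mul_right_cancel₀ ha hl

/-- The functions `f i` on the closure of `D` and the functions `χ k`, each multiplied by the
truncated coordinates. -/
def separatingFamily (D : Set 𝔼 d) (R : ℝ) (f χ : ℕ → 𝔼 d → ℝ) :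
    (ℕ × Option (Fin d)) ⊕ (ℕ × Option (Fin d)) → 𝔼 d → ℝ
  | .inl (i, o) => (closure D).indicator (truncCoord R o * f i)
  | .inr (k, o) => truncCoord k o * χ k

theorem eq_of_forall_separatingFamily_eq_of_mem_closure {R : ℝ}
    (hR : ∀ x ∈ closure D, ‖x‖ ≤ R) {f χ : ℕ → 𝔼 d → ℝ} {x y : 𝔼 d} (hx : x ∈ closure D)
    {i : ℕ} (hi : f i x ≠ 0)
    (h : ∀ q, separatingFamily D R f χ q x = separatingFamily D R f χ q y) : x = y := by
  have hval o : truncCoord R o x * f i x = (closure D).indicator (truncCoord R o * f i) y := by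
    rw [← Pi.mul_apply, ← Set.indicator_of_mem hx (truncCoord R o * f i)]
    exact h (Sum.inl (i, o))
  have hy : y ∈ closure D := by
    by_contra hy
    refine hi ?_
    simpa [truncCoord, hy] using hval none
  refine eq_of_forall_truncCoord_mul_eq (hR x hx) (hR y hy) hi (b := f i y) fun o => ?_
  rw [hval, Set.indicator_of_mem hy, Pi.mul_apply]

theorem eq_of_forall_separatingFamily_eq {R : ℝ} (hR : ∀ x ∈ closure D, ‖x‖ ≤ R)
    {B : ℕ → Set 𝔼 d} {f χ : ℕ → 𝔼 d → ℝ} {k : ℕ} (hf : ∀ x ∈ B k, ∃ i, f i x ≠ 0)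
    (hχ : ∀ x ∈ exteriorSet D k, χ k x = 1) {x y : 𝔼 d} (hx : x ∈ gluedNest D B k)
    (hy : y ∈ gluedNest D B k)
    (h : ∀ q, separatingFamily D R f χ q x = separatingFamily D R f χ q y) : x = y := by
  rcases hx with ⟨hxB, hxD⟩ | hxE
  · obtain ⟨i, hi⟩ := hf x hxB
    exact eq_of_forall_separatingFamily_eq_of_mem_closure hR hxD hi h
  rcases hy with ⟨hyB, hyD⟩ | hyE
  · obtain ⟨i, hi⟩ := hf y hyB
    exact (eq_of_forall_separatingFamily_eq_of_mem_closure hR hyD hi fun q => (h q).symm).symm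
  · refine eq_of_forall_truncCoord_mul_eq hxE.2 hyE.2 one_ne_zero (b := 1) fun o => ?_
    simpa [separatingFamily, hχ x hxE, hχ y hyE] using h (Sum.inr (k, o))

end TruncatedCoordinates

section QuasiContinuity

theorem ae_eq_indicator_closure {w f : 𝔼 d → ℝ}
    (hw : ∀ x ∉ D, w x = 0) (hfw : f =ᵐ[volume] w) :
    w =ᵐ[refMeasure j D] (closure D).indicator f := by
  filter_upwards [(refMeasure_absolutelyContinuous j D).ae_le hfw] with x hx
  by_cases hxD : x ∈ closure D
  · rw [Set.indicator_of_mem hxD, hx]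
  · rw [Set.indicator_of_notMem hxD, hw x fun h => hxD (subset_closure h)]

namespace IsLevyProfile

theorem exists_cutoffNest_continuousOn (hj : IsLevyProfile d j) {w : ℕ → 𝔼 d → ℝ}
    (hw : ∀ i, HasFiniteEnergy volume (jumpMeasure j) (w i)) :
    ∃ (B : ℕ → Set (𝔼 d)) (f e : ℕ → 𝔼 d → ℝ), IsCutoffNest volume (jumpMeasure j) B e ∧
      (∀ i k, ContinuousOn (f i) (B k)) ∧ ∀ i, f i =ᵐ[volume] w i :=
  (hasACMarginals_jumpMeasure j).exists_cutoffNest_continuousOn (fun i => (hw i).measurable)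
    fun i _ => hj.exists_continuous_energyOne_sub_le (hw i)

theorem exists_compact_nest (hj : IsLevyProfile d j) (hD : IsOpen D) (hne : D.Nonempty)
    (hb : Bornology.IsBounded D) (hfr : volume (frontier D) = 0) :
    ∃ A : ℕ → Set (𝔼 d), IsNest (jumpDomain (refMeasure j D) (restrictedJumpMeasure j D))
      (jumpForm (refMeasure j D) (restrictedJumpMeasure j D)) A ∧ ∀ k, IsCompact (A k) := by
  obtain ⟨B, -, e, hB, -, -⟩ := hj.exists_cutoffNest_continuousOn (w := 0) fun _ =>
    ⟨measurable_const, by simp [energyOne, lintegralSq, increment]⟩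
  exact ⟨gluedNest D B, hj.isNest_gluedNest hD hne hfr
    (hB.isNestOn (hasACMarginals_jumpMeasure j) D), isCompact_gluedNest hb hB.isClosed⟩

theorem exists_dense_quasiContinuous (hj : IsLevyProfile d j) (hD : IsOpen D) (hne : D.Nonempty)
    (hb : Bornology.IsBounded D) (hfr : volume (frontier D) = 0) :
    ∃ S : Set (Lp ℝ 2 (refMeasure j D)),
      IsFormDense (jumpDomain (refMeasure j D) (restrictedJumpMeasure j D))
        (jumpForm (refMeasure j D) (restrictedJumpMeasure j D)) S ∧
      ∀ u ∈ S, ∃ f : 𝔼 d → ℝ, IsQuasiContinuousVersion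
        (jumpDomain (refMeasure j D) (restrictedJumpMeasure j D))
        (jumpForm (refMeasure j D) (restrictedJumpMeasure j D)) u f := by
  have hc := hj.hasACMarginals hD hne
  refine ⟨{v ∈ jumpDomain (refMeasure j D) (restrictedJumpMeasure j D) |
    ∃ f : 𝔼 d → ℝ, IsQuasiContinuousVersion _ _ v f},
    hc.isFormDense (fun v hv => hv.1) fun u hu ε hε => ?_, fun v hv => hv.2⟩
  have hDu := hj.hasFiniteEnergy_indicator hD hne hu
  obtain ⟨B, f, e, hB, hf, hfw⟩ := hj.exists_cutoffNest_continuousOn fun _ : ℕ => hDu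
  have hnest := hj.isNest_gluedNest hD hne hfr (hB.isNestOn (hasACMarginals_jumpMeasure j) D)
  obtain ⟨h, hhc, hh⟩ := hj.exists_continuous_energyOne_indicator_compl_sub_lt hD hne hb hfr
    hu.measurable hu.memLp (lt_min hε one_pos)
  have hsub : u - (D.indicator u + h) = Dᶜ.indicator u - h := by
    nth_rw 1 [← Set.indicator_self_add_compl D u]
    abel
  rw [← hsub] at hh
  have hg := hc.hasFiniteEnergy_of_sub_lt_top hu (hDu.measurable.add hhc.measurable)
    (hh.trans ((min_le_right _ _).trans_lt ENNReal.one_lt_top))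
  obtain ⟨v, hv, hvg, hvf⟩ := hc.exists_isQuasiContinuousVersion hg
    ((ae_eq_indicator_closure (fun x hx => Set.indicator_of_notMem hx u) (hfw 0)).add
      (EventuallyEq.refl _ h)) hnest
    fun k => (continuousOn_indicator_gluedNest hB.isClosed (hf 0 k)).add hhc.continuousOn
  refine ⟨v, ⟨hv, _, hvf⟩, ?_⟩
  rw [hc.energyOne_congr ((EventuallyEq.refl _ u).sub hvg)]
  exact hh.trans_le (min_le_left _ _)

end IsLevyProfile

end QuasiContinuity

section Separation

namespace IsLevyProfile

theorem exists_isNestOn_nonvanishing (hj : IsLevyProfile d j) (D : Set (𝔼 d)) :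
    ∃ (B : ℕ → Set (𝔼 d)) (w f : ℕ → 𝔼 d → ℝ), IsNestOn volume (jumpMeasure j) D B ∧
      (∀ i, HasFiniteEnergy volume (jumpMeasure j) (w i)) ∧ (∀ i, ∀ x ∉ D, w i x = 0) ∧
      (∀ i, f i =ᵐ[volume] w i) ∧ (∀ i k, ContinuousOn (f i) (B k)) ∧
      ∀ k, ∀ x ∈ B k, ∃ i, f i x ≠ 0 := by
  have hc := hasACMarginals_jumpMeasure (d := d) j
  obtain ⟨w, hw, hdense⟩ := hc.exists_countable_dense
    (S := {u | HasFiniteEnergy volume (jumpMeasure j) u ∧ ∀ x ∉ D, u x = 0})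
    ⟨0, ⟨measurable_const, by simp [energyOne, lintegralSq, increment]⟩, fun _ _ => rfl⟩
    fun u hu => hu.1
  obtain ⟨B, f, e, hB, hf, hfw⟩ := hj.exists_cutoffNest_continuousOn fun i => (hw i).1
  exact ⟨nonvanishingSet B f, w, f,
    hB.isNestOn_nonvanishingSet hc (fun i => (hw i).1) (fun i => (hw i).2) hf hfw
      fun u hu hu0 => hdense u ⟨hu, hu0⟩,
    fun i => (hw i).1, fun i => (hw i).2, hfw,
    fun i k => (hf i k).mono fun _ hx => (mem_nonvanishingSet.1 hx).1,
    fun k x => exists_ne_zero_of_mem_nonvanishingSet⟩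

theorem hasFiniteEnergy_of_continuous (hj : IsLevyProfile d j) (hD : MeasurableSet D)
    (hb : Bornology.IsBounded D) {h : 𝔼 d → ℝ} (hh : Continuous h) {k : ℕ}
    (h0 : ∀ x ∉ exteriorSet D k, h x = 0) :
    HasFiniteEnergy (refMeasure j D) (restrictedJumpMeasure j D) h := by
  have hE := (isClosed_exteriorSet D k).measurableSet
  have : IsFiniteMeasure ((refMeasure j D).restrict (exteriorSet D k)) :=
    ⟨by simpa using hj.refMeasure_exteriorSet_lt_top hD hb k⟩
  obtain ⟨M, hM⟩ := (isCompact_exteriorSet D k).exists_bound_of_continuousOn hh.continuousOn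
  have hL2 : MemLp h 2 (refMeasure j D) := by
    rw [← Set.indicator_eq_self.2 (Function.support_subset_iff'.2 h0),
      memLp_indicator_iff_restrict hE]
    exact MemLp.of_bound hh.aestronglyMeasurable M ((ae_restrict_mem hE).mono hM)
  exact ⟨hh.measurable, (hj.energyOne_le_of_zero_on hD hh.measurable fun x hx =>
    h0 x (notMem_exteriorSet_of_mem_closure (subset_closure hx) k)).trans_lt
      (ENNReal.mul_lt_top (by simp)
        ((memLp_two_iff_lintegralSq_lt_top hh.aestronglyMeasurable).1 hL2))⟩

theorem exists_isQuasiContinuousVersion_separatingFamily (hj : IsLevyProfile d j)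
    (hD : IsOpen D) (hne : D.Nonempty) (hb : Bornology.IsBounded D)
    (hfr : volume (frontier D) = 0) {B : ℕ → Set (𝔼 d)}
    (hB : IsNestOn volume (jumpMeasure j) D B) {R : ℝ} (hR : 0 ≤ R) {w f χ : ℕ → 𝔼 d → ℝ}
    (hw : ∀ i, HasFiniteEnergy volume (jumpMeasure j) (w i)) (hw0 : ∀ i, ∀ x ∉ D, w i x = 0)
    (hfw : ∀ i, f i =ᵐ[volume] w i) (hf : ∀ i k, ContinuousOn (f i) (B k))
    (hχ : ∀ k, Continuous (χ k)) (hχ0 : ∀ k, ∀ x ∉ exteriorSet D (k + 1), χ k x = 0)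
    (q : (ℕ × Option (Fin d)) ⊕ (ℕ × Option (Fin d))) :
    ∃ u ∈ jumpDomain (refMeasure j D) (restrictedJumpMeasure j D),
      IsQuasiContinuousVersion (jumpDomain (refMeasure j D) (restrictedJumpMeasure j D))
        (jumpForm (refMeasure j D) (restrictedJumpMeasure j D)) u
        (separatingFamily D R f χ q) := by
  have hc := hj.hasACMarginals hD hne
  have hnest := hj.isNest_gluedNest hD hne hfr hB
  rcases q with ⟨i, o⟩ | ⟨k, o⟩
  · have hφ := lipschitzWith_truncCoord (d := d) R o
    have hφw := hj.hasFiniteEnergy_mul_of_lipschitz hφ (abs_truncCoord_le hR o) (hw i)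
    have hφw0 : ∀ x ∉ D, (truncCoord R o * w i) x = 0 := fun x hx =>
      mul_eq_zero_of_right _ (hw0 i x hx)
    have hφw' : HasFiniteEnergy (refMeasure j D) (restrictedJumpMeasure j D)
        (truncCoord R o * w i) := by
      refine ⟨hφw.measurable, ?_⟩
      rw [hj.energyOne_of_zero_off hD.measurableSet hφw.measurable hφw0]
      exact hφw.lt_top
    obtain ⟨u, hu, -, huf⟩ := hc.exists_isQuasiContinuousVersion hφw'
      (ae_eq_indicator_closure hφw0 ((EventuallyEq.refl _ (truncCoord R o)).mul (hfw i)))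
      hnest fun k => continuousOn_indicator_gluedNest hB.isClosed
        (hφ.continuous.continuousOn.mul (hf i k))
    exact ⟨u, hu, huf⟩
  · have hcont : Continuous (truncCoord k o * χ k) :=
      (lipschitzWith_truncCoord _ o).continuous.mul (hχ k)
    obtain ⟨u, hu, -, huf⟩ := hc.exists_isQuasiContinuousVersion
      (hj.hasFiniteEnergy_of_continuous hD.measurableSet hb hcont fun x hx =>
        mul_eq_zero_of_right _ (hχ0 k x hx)) (EventuallyEq.refl _ _) hnest
      fun _ => hcont.continuousOn
    exact ⟨u, hu, huf⟩

theorem exists_separating (hj : IsLevyProfile d j) (hD : IsOpen D) (hne : D.Nonempty)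
    (hb : Bornology.IsBounded D) (hfr : volume (frontier D) = 0) :
    ∃ (u : ℕ → Lp ℝ 2 (refMeasure j D)) (f : ℕ → 𝔼 d → ℝ) (N : Set (𝔼 d)),
      (∀ n, u n ∈ jumpDomain (refMeasure j D) (restrictedJumpMeasure j D) ∧
        IsQuasiContinuousVersion (jumpDomain (refMeasure j D) (restrictedJumpMeasure j D))
          (jumpForm (refMeasure j D) (restrictedJumpMeasure j D)) (u n) (f n)) ∧
      IsPolar (jumpDomain (refMeasure j D) (restrictedJumpMeasure j D))
        (jumpForm (refMeasure j D) (restrictedJumpMeasure j D)) N ∧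
      ∀ x ∉ N, ∀ y ∉ N, x ≠ y → ∃ n, f n x ≠ f n y := by
  obtain ⟨B, w, f, hB, hw, hw0, hfw, hf, hf0⟩ := hj.exists_isNestOn_nonvanishing D
  obtain ⟨R, hR0, hR⟩ := hb.closure.exists_pos_norm_le
  choose χ hχ hχ1 hχ0 _ using exists_exteriorSet_cutoff D
  choose u hu huf using
    hj.exists_isQuasiContinuousVersion_separatingFamily hD hne hb hfr hB hR0.le hw hw0 hfw hf hχ hχ0
  obtain ⟨s, hs⟩ := exists_surjective_nat ((ℕ × Option (Fin d)) ⊕ (ℕ × Option (Fin d)))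
  refine ⟨u ∘ s, separatingFamily D R f χ ∘ s, ⋂ k, (gluedNest D B k)ᶜ,
    fun n => ⟨hu _, huf _⟩, ⟨_, hj.isNest_gluedNest hD hne hfr hB, subset_rfl⟩,
    fun x hx y hy hxy => ?_⟩
  simp only [Set.mem_iInter, Set.mem_compl_iff, not_forall, not_not] at hx hy
  obtain ⟨k, hk⟩ := hx
  obtain ⟨l, hl⟩ := hy
  have hmono := monotone_gluedNest D hB.mono
  by_contra! hcon
  exact hxy (eq_of_forall_separatingFamily_eq hR (hf0 _) (hχ1 _)
    (hmono (le_max_left k l) hk) (hmono (le_max_right k l) hl) (hs.forall.2 hcon))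

end IsLevyProfile

end Separation

end NonlocalForm

end

theorem theorem4p3_general (d : ℕ)
    (j : ℝ → ℝ) (hj_pos : ∀ r, 0 < r → 0 < j r) (hj_anti : AntitoneOn j (Set.Ioi 0))
    (hj_levy : ∫⁻ x : EuclideanSpace ℝ (Fin d),
      ENNReal.ofReal (min 1 (‖x‖ ^ 2) * j ‖x‖) < ∞)
    (D : Set (EuclideanSpace ℝ (Fin d))) (hD_open : IsOpen D) (hD_nonempty : D.Nonempty)
    (hD_bdd : Bornology.IsBounded D) (hD_frontier : volume (frontier D) = 0) :
    DirichletForm.IsQuasiRegularDirichletForm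
      (NonlocalForm.formDomain j D) (NonlocalForm.formLp j D) := by
  have hj : NonlocalForm.IsLevyProfile d j := ⟨hj_pos, hj_anti, hj_levy⟩
  rw [hj.formDomain_eq hD_open.measurableSet, hj.formLp_eq hD_open.measurableSet]
  exact
    { sigmaFinite := hj.sigmaFinite_refMeasure hD_open hD_nonempty hD_bdd hD_frontier
      fullSupport := (hj.absolutelyContinuous_refMeasure hD_open hD_nonempty).isOpenPosMeasure
      isDirichletForm := (hj.hasACMarginals hD_open hD_nonempty).isDirichletForm
        (hj.dense_jumpDomain hD_open hD_nonempty hD_bdd)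
      exists_compact_nest := hj.exists_compact_nest hD_open hD_nonempty hD_bdd hD_frontier
      exists_dense_quasiContinuous :=
        hj.exists_dense_quasiContinuous hD_open hD_nonempty hD_bdd hD_frontier
      exists_separating := hj.exists_separating hD_open hD_nonempty hD_bdd hD_frontier }

theorem theorem4p3 (d : ℕ) (hd : 2 ≤ d)
    (j : ℝ → ℝ) (hj_pos : ∀ r, 0 < r → 0 < j r) (hj_anti : AntitoneOn j (Set.Ioi 0))
    (hj_levy : ∫⁻ x : EuclideanSpace ℝ (Fin d),
      ENNReal.ofReal (min 1 (‖x‖ ^ 2) * j ‖x‖) < ∞)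
    (D : Set (EuclideanSpace ℝ (Fin d))) (hD_open : IsOpen D) (hD_nonempty : D.Nonempty)
    (hD_bdd : Bornology.IsBounded D) (hD_frontier : volume (frontier D) = 0) :
    DirichletForm.IsQuasiRegularDirichletForm
      (NonlocalForm.formDomain j D) (NonlocalForm.formLp j D) :=
  theorem4p3_general d j hj_pos hj_anti hj_levy D hD_open hD_nonempty hD_bdd hD_frontier
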